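/- Let $U\subset\mathbb{R}^2$ be a connected and simply connected open set. Let $(a_{ij})\in W^{1,2}_{\mathrm{loc}}\cap L^\infty_{\mathrm{loc}}(U)$ be a field of symmetric positive definite $2\times 2$ matrices whose eigenvalues are locally uniformly bounded from below (for every compact $K\subset U$ there is $C>0$ such that all eigenvalues of $(a_{ij}(x))$ are $\ge C$ for a.e. $x\in K$), and let $(b_{ij})\in L^2_{\mathrm{loc}}(U)$ be a field of symmetric $2\times 2$ matrices. With $(a^{ij})=(a_{ij})^{-1}$, weak derivatives $\partial_i$, and the summation convention, set $$b_i^j=a^{jk}b_{ik},\qquad \Gamma^k_{ij}=\tfrac12 a^{kl}(\partial_j a_{il}+\partial_i a_{jl}-\partial_l a_{ij}),\qquad \Gamma_{ijk}=a_{kl}\Gamma^l_{ij},$$ $$G=\begin{pmatrix}a_{11}&a_{12}&0\\a_{21}&a_{22}&0\\0&0&1\end{pmatrix}^{1/2},\qquad \Gamma_i=\begin{pmatrix}\Gamma^1_{i1}&\Gamma^1_{i2}&-b_i^1\\ \Gamma^2_{i1}&\Gamma^2_{i2}&-b_i^2\\ b_{i1}&b_{i2}&0\end{pmatrix},\qquad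 \Omega_i=(G\Gamma_i-\partial_iG)G^{-1}.$$ Then $G\in W^{1,2}_{\mathrm{loc}}(U)$, $\Gamma_i\in L^2_{\mathrm{loc}}(U)$, and $\Omega_i\in L^2_{\mathrm{loc}}(U)$ is antisymmetric almost everywhere. Moreover, the compatibility condition $$\partial_i\Omega_j-\partial_j\Omega_i=\Omega_j\Omega_i-\Omega_i\Omega_j\quad\text{in }\mathcal{D}'(U)\quad\text{for all } i,j\in\{1,2\}$$ holds if and only if the Gauss--Codazzi--Mainardi equations $$\partial_j\Gamma_{ikl}-\partial_k\Gamma_{ijl}+\Gamma^m_{ij}\Gamma_{klm}-\Gamma^m_{ik}\Gamma_{jlm}=b_{ik}b_{jl}-b_{ij}b_{kl},\qquad \partial_jb_{ik}-\partial_kb_{ij}+\Gamma^m_{ik}b_{jm}-\Gamma^m_{ij}b_{km}=0$$ hold in $\mathcal{D}'(U)$ for all $i,j,k,l\in\{1,2\}$. Both are also equivalent to the condition $$\partial_i\Gamma_j+\Gamma_i\Gamma_j=\partial_j\Gamma_i+\Gamma_j\Gamma_i\quad\text{in }\mathcal{D}'(U)\quad\text{for all } i,j\in\{1,2\}.$$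 -/

import Mathlib

open MeasureTheory TopologicalSpace
open scoped Distributions LineDeriv ENNReal

namespace SurfaceTheory

/-- The Euclidean plane. -/
abbrev Plane : Type := EuclideanSpace ℝ (Fin 2)

/-- The standard basis vectors of the plane. The indices `1, 2` of the mathematical text are the
elements `0, 1` of `Fin 2`. -/
noncomputable def e (i : Fin 2) : Plane := EuclideanSpace.single i 1

/-- The distribution `φ ↦ ∫ φ f` on `U` given by a locally integrable function `f`
(the zero distribution if `f` is not locally integrable on `U`). -/
noncomputable def toDist (U : Opens Plane) (f : Plane → ℝ) : 𝓓'(U, ℝ) :=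
  TestFunction.integralAgainstBilinCLM (ContinuousLinearMap.mul ℝ ℝ) volume f

/-- `f ∈ L^p_loc(U)`. -/
def MemLpLoc (U : Opens Plane) (p : ℝ≥0∞) (f : Plane → ℝ) : Prop :=
  ∀ K : Set Plane, IsCompact K → K ⊆ U → MemLp f p (volume.restrict K)

/-- The locally integrable function `g` is the `i`-th weak partial derivative on `U` of the locally
integrable function `f`, that is, `∂ᵢ f = g` in `𝓓'(U)`. -/
def IsWeakPartial (U : Opens Plane) (i : Fin 2) (f g : Plane → ℝ) : Prop :=
  LocallyIntegrableOn f U ∧ LocallyIntegrableOn g U ∧ ∂_{e i} (toDist U f) = toDist U g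

/-- `f ∈ W^{1,2}_loc(U)`. -/
def MemW12Loc (U : Opens Plane) (f : Plane → ℝ) : Prop :=
  MemLpLoc U 2 f ∧ ∀ i, ∃ g, MemLpLoc U 2 g ∧ IsWeakPartial U i f g

open Classical in
/-- A representative of the `i`-th weak partial derivative of `f` on `U`, which is unique up to
equality almost everywhere on `U` (zero if `f` is not weakly differentiable). -/
noncomputable def weakPartial (U : Opens Plane) (i : Fin 2) (f : Plane → ℝ) : Plane → ℝ :=
  if h : ∃ g, IsWeakPartial U i f g then h.choose else 0

section Coefficients

variable (U : Opens Plane) (a b : Plane → Matrix (Fin 2) (Fin 2) ℝ)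

/-- The mixed components `b_i^j = a^{jk} b_{ik}`. -/
noncomputable def bMixed (i j : Fin 2) (x : Plane) : ℝ :=
  ∑ k, (a x)⁻¹ j k * b x i k

/-- The Christoffel symbols
`Γ^k_{ij} = (1/2) a^{kl} (∂_j a_{il} + ∂_i a_{jl} - ∂_l a_{ij})`. -/
noncomputable def christoffel (k i j : Fin 2) (x : Plane) : ℝ :=
  1 / 2 * ∑ l, (a x)⁻¹ k l *
    (weakPartial U j (fun y => a y i l) x + weakPartial U i (fun y => a y j l) x
      - weakPartial U l (fun y => a y i j) x)

/-- The Christoffel symbols with lowered index, `Γ_{ijk} = a_{kl} Γ^l_{ij}`. -/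
noncomputable def christoffelLow (i j k : Fin 2) (x : Plane) : ℝ :=
  ∑ l, a x k l * christoffel U a l i j x

open scoped MatrixOrder in
/-- `G`, the symmetric positive semidefinite square root of the three-dimensional extension
of `(a_{ij})`. -/
noncomputable def G (x : Plane) : Matrix (Fin 3) (Fin 3) ℝ :=
  CFC.sqrt !![a x 0 0, a x 0 1, 0; a x 1 0, a x 1 1, 0; 0, 0, 1]

/-- The entrywise weak partial derivative `∂_i G`. -/
noncomputable def dG (i : Fin 2) (x : Plane) : Matrix (Fin 3) (Fin 3) ℝ :=
  Matrix.of fun r s => weakPartial U i (fun y => G a y r s) x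

/-- The matrix fields `Γ_i`. -/
noncomputable def Gam (i : Fin 2) (x : Plane) : Matrix (Fin 3) (Fin 3) ℝ :=
  !![christoffel U a 0 i 0 x, christoffel U a 0 i 1 x, -bMixed a b i 0 x;
     christoffel U a 1 i 0 x, christoffel U a 1 i 1 x, -bMixed a b i 1 x;
     b x i 0, b x i 1, 0]

/-- The matrix fields `Ω_i = (G Γ_i - ∂_i G) G⁻¹`. -/
noncomputable def Om (i : Fin 2) (x : Plane) : Matrix (Fin 3) (Fin 3) ℝ :=
  (G a x * Gam U a b i x - dG U a i x) * (G a x)⁻¹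

/-- The compatibility condition `∂_i Ω_j - ∂_j Ω_i = Ω_j Ω_i - Ω_i Ω_j` in `𝓓'(U)`. -/
def Compatibility : Prop :=
  ∀ i j : Fin 2, ∀ r s : Fin 3,
    ∂_{e i} (toDist U fun x => Om U a b j x r s) - ∂_{e j} (toDist U fun x => Om U a b i x r s)
      = toDist U fun x => (Om U a b j x * Om U a b i x - Om U a b i x * Om U a b j x) r s

/-- The condition `∂_i Γ_j + Γ_i Γ_j = ∂_j Γ_i + Γ_j Γ_i` in `𝓓'(U)`. -/
def GammaCompatibility : Prop :=
  ∀ i j : Fin 2, ∀ r s : Fin 3,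
    ∂_{e i} (toDist U fun x => Gam U a b j x r s)
        + toDist U (fun x => (Gam U a b i x * Gam U a b j x) r s)
      = ∂_{e j} (toDist U fun x => Gam U a b i x r s)
        + toDist U (fun x => (Gam U a b j x * Gam U a b i x) r s)

/-- The Gauss equations in `𝓓'(U)`:
`∂_j Γ_{ikl} - ∂_k Γ_{ijl} + Γ^m_{ij} Γ_{klm} - Γ^m_{ik} Γ_{jlm} = b_{ik} b_{jl} - b_{ij} b_{kl}`. -/
def GaussEquations : Prop :=
  ∀ i j k l : Fin 2,
    ∂_{e j} (toDist U (christoffelLow U a i k l)) - ∂_{e k} (toDist U (christoffelLow U a i j l))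
        + toDist U (fun x => ∑ m, (christoffel U a m i j x * christoffelLow U a k l m x
            - christoffel U a m i k x * christoffelLow U a j l m x))
      = toDist U (fun x => b x i k * b x j l - b x i j * b x k l)

/-- The Codazzi–Mainardi equations in `𝓓'(U)`:
`∂_j b_{ik} - ∂_k b_{ij} + Γ^m_{ik} b_{jm} - Γ^m_{ij} b_{km} = 0`. -/
def CodazziMainardiEquations : Prop :=
  ∀ i j k : Fin 2,
    ∂_{e j} (toDist U fun x => b x i k) - ∂_{e k} (toDist U fun x => b x i j)
        + toDist U (fun x => ∑ m, (christoffel U a m i k x * b x j m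
            - christoffel U a m i j x * b x k m))
      = 0

end Coefficients

end SurfaceTheory

open SurfaceTheory

/-! All three conditions are the same curl equation in different gauges. Write `A` for the extended
metric, so `A = G²`. By definition `Ωᵢ G = G Γᵢ - ∂ᵢG` almost everywhere. The product rule expands
the curls of `Ω G` and `G Γ`, and the curl of `∂G` vanishes because distributional derivatives
commute. Substituting `∂ᵢG = G Γᵢ - Ωᵢ G` makes the quadratic terms match, and `G` is invertible, so
the equations for `Ω` and `Γ` are equivalent (`IsMetric.hasCurl_Om_iff`).

Multiplying by `A` lowers an index. Metric compatibility of the Christoffel symbols reads `∂ᵢA = AΓᵢ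
+ (AΓᵢ)ᵀ`, so the equation for `Γ` becomes `∂ᵢ(AΓⱼ) - ∂ⱼ(AΓᵢ) = ΓᵢᵀAΓⱼ - ΓⱼᵀAΓᵢ`
(`IsMetric.hasCurl_Gam_iff`). Entry by entry, the 2×2 block is Gauss, the last row and the last
column are both Codazzi–Mainardi, and the corner is trivial (`IsMetric.hasCurl_lowGam_iff`). Metric
compatibility also gives the antisymmetry of `Ωᵢ`: the symmetric part of `G Ωᵢ G` is half of `∂ᵢA -
∂ᵢ(G²) = 0`.

The analytic difficulty is low regularity: the connection matrices are only `L²`, and only the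
combination `∂ᵢp - ∂ⱼq` is a function. `lineDeriv_sub_lineDeriv_mul` multiplies such an identity by
`u ∈ W^{1,2}_loc ∩ L^∞_loc`, by testing it with mollifications of `φu` and passing to the limit.
That `G` and `G⁻¹` have this regularity follows from an explicit formula for the square root of a
2×2 matrix, the product rule, and the chain rule `MemWB.comp` for `t ↦ t^(-1/2)`. -/

namespace SurfaceTheory

/-! ### Weak convergence of mollifications. -/

section Mollification

open Filter ContinuousLinearMap
open scoped Convolution Topology

variable {E : Type*} [NormedAddCommGroup E] [NormedSpace ℝ E] [FiniteDimensional ℝ E]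
  [MeasurableSpace E] [BorelSpace E] {μ : Measure E} [μ.IsAddHaarMeasure]

lemma ae_comp_sub_left {p : E → Prop} (h : ∀ᵐ y ∂μ, p y) (x : E) : ∀ᵐ t ∂μ, p (x - t) :=
  (Measure.measurePreserving_sub_left μ x).quasiMeasurePreserving.ae h

lemma abs_convolution_le {ρ h : E → ℝ} {M : ℝ} (hρ0 : ∀ x, 0 ≤ ρ x) (hρi : Integrable ρ μ)
    (hρ1 : ∫ x, ρ x ∂μ = 1) (hM : ∀ᵐ y ∂μ, |h y| ≤ M) (x : E) :
    |(ρ ⋆[lsmul ℝ ℝ, μ] h) x| ≤ M := by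
  rw [convolution_def]
  calc |∫ t, lsmul ℝ ℝ (ρ t) (h (x - t)) ∂μ| ≤ ∫ t, ρ t * M ∂μ := by
        rw [← Real.norm_eq_abs]
        refine norm_integral_le_of_norm_le (hρi.mul_const M) ?_
        filter_upwards [ae_comp_sub_left hM x] with t ht
        simp only [lsmul_apply, smul_eq_mul, norm_mul, Real.norm_eq_abs, abs_of_nonneg (hρ0 t)]
        exact mul_le_mul_of_nonneg_left ht (hρ0 t)
    _ = M := by rw [integral_mul_const, hρ1, one_mul]

/-- Testing the convolution of an `L²` function with a probability density against an `L²`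
function. -/
lemma abs_integral_mul_convolution_le {ρ f h : E → ℝ} (hρc : Continuous ρ)
    (hρs : HasCompactSupport ρ) (hρ0 : ∀ x, 0 ≤ ρ x) (hρ1 : ∫ x, ρ x ∂μ = 1)
    (hf : MemLp f 2 μ) (hh : MemLp h 2 μ) :
    Integrable (fun x => f x * (ρ ⋆[lsmul ℝ ℝ, μ] h) x) μ ∧
      |∫ x, f x * (ρ ⋆[lsmul ℝ ℝ, μ] h) x ∂μ| ≤ (∫ x, f x ^ 2 ∂μ + ∫ x, h x ^ 2 ∂μ) / 2 := by
  have hρi : Integrable ρ μ := hρc.integrable_of_hasCompactSupport hρs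
  have hhl : LocallyIntegrable h μ := hh.locallyIntegrable (by norm_num)
  have hh2 : Integrable (fun x => h x ^ 2) μ := hh.integrable_sq
  have hf2 : Integrable (fun x => f x ^ 2) μ := hf.integrable_sq
  have hc2 : Integrable (ρ ⋆[lsmul ℝ ℝ, μ] fun x => h x ^ 2) μ :=
    hρi.integrable_convolution (lsmul ℝ ℝ) hh2
  -- Average `|f x| |h (x - t)| ≤ (f x ^ 2 + h (x - t) ^ 2) / 2` against the probability density `ρ
  -- t`; integrating in `x` then uses `∫ ρ ⋆ h² = ∫ h²`.
  have key : ∀ x, ‖f x * (ρ ⋆[lsmul ℝ ℝ, μ] h) x‖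
      ≤ (f x ^ 2 + (ρ ⋆[lsmul ℝ ℝ, μ] fun x => h x ^ 2) x) / 2 := by
    intro x
    have e2 := (hρs.convolutionExists_left (lsmul ℝ ℝ) hρc hh2.locallyIntegrable x).integrable
    have e3 : ∫ t, (f x ^ 2 * ρ t + ρ t * h (x - t) ^ 2) / 2 ∂μ
        = (f x ^ 2 + (ρ ⋆[lsmul ℝ ℝ, μ] fun x => h x ^ 2) x) / 2 := by
      simp only [lsmul_apply, smul_eq_mul] at e2
      rw [integral_div, integral_add (hρi.const_mul _) e2, integral_const_mul, hρ1, convolution_def]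
      simp
    rw [← e3, convolution_def, ← integral_const_mul]
    refine norm_integral_le_of_norm_le (((hρi.const_mul _).add e2).div_const 2) ?_
    refine Eventually.of_forall fun t => ?_
    simp only [lsmul_apply, smul_eq_mul, norm_mul, Real.norm_eq_abs, abs_of_nonneg (hρ0 t)]
    have := mul_nonneg (hρ0 t) (sq_nonneg (|f x| - |h (x - t)|))
    rw [sub_sq, sq_abs, sq_abs] at this
    linarith
  have hmeas : AEStronglyMeasurable (fun x => f x * (ρ ⋆[lsmul ℝ ℝ, μ] h) x) μ :=
    hf.1.mul (hρs.continuous_convolution_left (lsmul ℝ ℝ) hρc hhl).aestronglyMeasurable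
  refine ⟨((hf2.add hc2).div_const 2).mono' hmeas (Eventually.of_forall key), ?_⟩
  have h1 := norm_integral_le_of_norm_le ((hf2.add hc2).div_const 2) (Eventually.of_forall key)
  rw [Real.norm_eq_abs] at h1
  refine h1.trans (le_of_eq ?_)
  simp only [Pi.add_apply]
  rw [integral_div, integral_add hf2 hc2, integral_convolution (lsmul ℝ ℝ) hρi hh2, hρ1]
  simp

variable {ρ : ℕ → ContDiffBump (0 : E)}

lemma tendsto_integral_mul_mollify_of_bounded (hρ : Tendsto (fun n => (ρ n).rOut) atTop (𝓝 0))
    (hρ' : ∀ n, (ρ n).rOut ≤ 2 * (ρ n).rIn) {f h : E → ℝ} {M : ℝ} (hf : Integrable f μ)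
    (hh : LocallyIntegrable h μ) (hM : ∀ᵐ y ∂μ, |h y| ≤ M) :
    Tendsto (fun n => ∫ x, f x * ((ρ n).normed μ ⋆[lsmul ℝ ℝ, μ] h) x ∂μ) atTop
      (𝓝 (∫ x, f x * h x ∂μ)) := by
  refine tendsto_integral_of_dominated_convergence (fun x => ‖f x‖ * M) ?_ (hf.norm.mul_const M)
    ?_ ?_
  · intro n
    exact hf.1.mul ((ρ n).hasCompactSupport_normed.continuous_convolution_left (lsmul ℝ ℝ)
      (ρ n).continuous_normed hh).aestronglyMeasurable
  · intro n
    refine Eventually.of_forall fun x => ?_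
    rw [norm_mul]
    exact mul_le_mul_of_nonneg_left (abs_convolution_le (ρ n).nonneg_normed (ρ n).integrable_normed
      (ρ n).integral_normed hM x) (norm_nonneg _)
  · filter_upwards [ContDiffBump.ae_convolution_tendsto_right_of_locallyIntegrable (K := 2) hρ
      (Eventually.of_forall hρ') hh] with x hx
    exact hx.const_mul _

/-- Approximate `h` in `L²` by a continuous compactly supported `g`, to which the bounded case
applies; the error `h - g` is controlled uniformly in `n` by `abs_integral_mul_convolution_le`. -/
lemma tendsto_integral_mul_mollify_of_memLp_two
    (hρ : Tendsto (fun n => (ρ n).rOut) atTop (𝓝 0))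
    (hρ' : ∀ n, (ρ n).rOut ≤ 2 * (ρ n).rIn) {f h : E → ℝ} (hf : MemLp f 2 μ)
    (hf1 : Integrable f μ) (hh : MemLp h 2 μ) :
    Tendsto (fun n => ∫ x, f x * ((ρ n).normed μ ⋆[lsmul ℝ ℝ, μ] h) x ∂μ) atTop
      (𝓝 (∫ x, f x * h x ∂μ)) := by
  rw [Metric.tendsto_atTop]
  intro ε hε
  set F := ∫ x, f x ^ 2 ∂μ with hF
  have hF0 : 0 ≤ F := integral_nonneg fun _ => sq_nonneg _
  -- The bound on `∫ f (ρ ⋆ (h - g))` is a sum of squares, not a product of norms. Rescaling to `c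
  -- f` and `c⁻¹ (h - g)` makes it small: `c` first absorbs `f`, then `g` is chosen with error at
  -- most `c ^ 2 * (ε / 4)`.
  obtain ⟨c, hc, hcF⟩ : ∃ c : ℝ, 0 < c ∧ c ^ 2 * F ≤ ε / 4 := by
    refine ⟨√(ε / (4 * (F + 1))), Real.sqrt_pos.2 (by positivity), ?_⟩
    rw [Real.sq_sqrt (by positivity), div_mul_eq_mul_div, div_le_div_iff₀ (by positivity) (by norm_num)]
    nlinarith
  obtain ⟨g, hgs, hgε, hgc, hg⟩ := MemLp.exists_hasCompactSupport_integral_rpow_sub_le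
    (p := 2) (by norm_num) (by simpa using hh) (show 0 < c ^ 2 * (ε / 4) by positivity)
  simp only [ENNReal.ofReal_ofNat, Real.rpow_two, Real.norm_eq_abs, sq_abs] at hg hgε
  have hr : MemLp (fun x => h x - g x) 2 μ := hh.sub hg
  have hgl : LocallyIntegrable g μ := hgc.locallyIntegrable
  have hhl : LocallyIntegrable h μ := hh.locallyIntegrable (by norm_num)
  obtain ⟨M, hM⟩ := hgc.bounded_above_of_compact_support hgs
  have hcf : MemLp (fun x => c * f x) 2 μ := hf.const_mul c
  have hrc : MemLp (fun x => c⁻¹ * (h x - g x)) 2 μ := hr.const_mul c⁻¹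
  have hI : (∫ x, (c * f x) ^ 2 ∂μ + ∫ x, (c⁻¹ * (h x - g x)) ^ 2 ∂μ) / 2 ≤ ε / 4 := by
    simp only [mul_pow]
    rw [integral_const_mul, integral_const_mul]
    have : (c⁻¹) ^ 2 * ∫ x, (h x - g x) ^ 2 ∂μ ≤ (c⁻¹) ^ 2 * (c ^ 2 * (ε / 4)) :=
      mul_le_mul_of_nonneg_left hgε (by positivity)
    rw [← mul_assoc, ← mul_pow, inv_mul_cancel₀ hc.ne', one_pow, one_mul] at this
    linarith
  have hlim : |∫ x, f x * h x ∂μ - ∫ x, f x * g x ∂μ| ≤ ε / 4 := by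
    have i1 : Integrable (fun x => f x * h x) μ := hf.integrable_mul hh
    have i2 : Integrable (fun x => f x * g x) μ := hf.integrable_mul hg
    rw [← integral_sub i1 i2]
    have hi := (hcf.integrable_sq.add hrc.integrable_sq).div_const 2
    have := norm_integral_le_of_norm_le (f := fun x => f x * h x - f x * g x) hi
      (Eventually.of_forall fun x => by
        have e : f x * h x - f x * g x = (c * f x) * (c⁻¹ * (h x - g x)) := by
          field_simp
        rw [e, Real.norm_eq_abs, abs_mul]
        have := sq_nonneg (|c * f x| - |c⁻¹ * (h x - g x)|)
        rw [sub_sq, sq_abs, sq_abs] at this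
        simp only [Pi.add_apply]
        linarith)
    rw [Real.norm_eq_abs] at this
    refine this.trans ?_
    simp only [Pi.add_apply]
    rw [integral_div, integral_add hcf.integrable_sq hrc.integrable_sq]
    exact hI
  have hdiff : ∀ n, |∫ x, f x * ((ρ n).normed μ ⋆[lsmul ℝ ℝ, μ] h) x ∂μ
      - ∫ x, f x * ((ρ n).normed μ ⋆[lsmul ℝ ℝ, μ] g) x ∂μ| ≤ ε / 4 := by
    intro n
    have cs := (ρ n).hasCompactSupport_normed (μ := μ)
    have cc := (ρ n).continuous_normed (μ := μ)
    have b := fun {a k : E → ℝ} (ha : MemLp a 2 μ) (hk : MemLp k 2 μ) =>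
      abs_integral_mul_convolution_le cc cs (ρ n).nonneg_normed (ρ n).integral_normed ha hk
    rw [← integral_sub (b hf hh).1 (b hf hg).1]
    have e : ∀ x, f x * ((ρ n).normed μ ⋆[lsmul ℝ ℝ, μ] h) x
        - f x * ((ρ n).normed μ ⋆[lsmul ℝ ℝ, μ] g) x
        = (c * f x) * ((ρ n).normed μ ⋆[lsmul ℝ ℝ, μ] fun x => c⁻¹ * (h x - g x)) x := by
      intro x
      have e1 := (cs.convolutionExists_left (lsmul ℝ ℝ) cc hhl x).integrable
      have e2 := (cs.convolutionExists_left (lsmul ℝ ℝ) cc hgl x).integrable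
      rw [← mul_sub, convolution_def, convolution_def, convolution_def, ← integral_sub e1 e2,
        ← integral_const_mul, ← integral_const_mul]
      refine integral_congr_ae (Eventually.of_forall fun t => ?_)
      simp only [lsmul_apply, smul_eq_mul]
      field_simp
    simp only [e]
    exact (b hcf hrc).2.trans hI
  obtain ⟨N, hN⟩ := Metric.tendsto_atTop.1 (tendsto_integral_mul_mollify_of_bounded hρ hρ' hf1
    hgl (Eventually.of_forall hM)) (ε / 4) (by positivity)
  refine ⟨N, fun n hn => ?_⟩
  have h1 := hN n hn
  have h2 := hdiff n
  rw [Real.dist_eq] at h1 ⊢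
  rw [abs_le] at h2 hlim
  rw [abs_lt] at h1 ⊢
  constructor <;> linarith [h1.1, h1.2, h2.1, h2.2, hlim.1, hlim.2]

end Mollification

/-! ### Local Lebesgue spaces. -/

section Local

variable {U : Opens Plane} {p q r : ℝ≥0∞} {f g : Plane → ℝ}

lemma ae_restrict_of_subset {P : Plane → Prop} {K : Set Plane}
    (h : ∀ᵐ x ∂volume.restrict (U : Set Plane), P x) (hK : K ⊆ U) :
    ∀ᵐ x ∂volume.restrict K, P x :=
  ae_mono (Measure.restrict_mono hK le_rfl) h

lemma MemLpLoc.congr (hf : MemLpLoc U p f) (h : f =ᵐ[volume.restrict (U : Set Plane)] g) :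
    MemLpLoc U p g := fun K hK hKU =>
  (hf K hK hKU).ae_eq (ae_restrict_of_subset h hKU)

lemma MemLpLoc.add (hf : MemLpLoc U p f) (hg : MemLpLoc U p g) :
    MemLpLoc U p fun x => f x + g x := fun K hK hKU => (hf K hK hKU).add (hg K hK hKU)

lemma MemLpLoc.sub (hf : MemLpLoc U p f) (hg : MemLpLoc U p g) :
    MemLpLoc U p fun x => f x - g x := fun K hK hKU => (hf K hK hKU).sub (hg K hK hKU)

lemma MemLpLoc.neg (hf : MemLpLoc U p f) : MemLpLoc U p fun x => -f x :=
  fun K hK hKU => (hf K hK hKU).neg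

lemma MemLpLoc.sum {ι : Type*} (s : Finset ι) {f : ι → Plane → ℝ}
    (hf : ∀ i ∈ s, MemLpLoc U p (f i)) : MemLpLoc U p fun x => ∑ i ∈ s, f i x :=
  fun K hK hKU => memLp_finsetSum s fun i hi => hf i hi K hK hKU

lemma memLpLoc_const (c : ℝ) : MemLpLoc U p fun _ => c := fun K hK _ => by
  have : IsFiniteMeasure (volume.restrict K) := ⟨by simpa using hK.measure_lt_top⟩
  exact memLp_const c

lemma MemLpLoc.mul [ENNReal.HolderTriple p q r] (hf : MemLpLoc U p f) (hg : MemLpLoc U q g) :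
    MemLpLoc U r fun x => f x * g x := fun K hK hKU => (hg K hK hKU).mul (hf K hK hKU)

lemma MemLpLoc.mono_exponent (hf : MemLpLoc U p f) (hqp : q ≤ p) : MemLpLoc U q f :=
  fun K hK hKU => by
    have : IsFiniteMeasure (volume.restrict K) := ⟨by simpa using hK.measure_lt_top⟩
    exact (hf K hK hKU).mono_exponent hqp

lemma MemLpLoc.locallyIntegrableOn (hf : MemLpLoc U p f) (hp : 1 ≤ p) :
    LocallyIntegrableOn f U := by
  rw [locallyIntegrableOn_iff U.isOpen.isLocallyClosed]
  intro K hKU hK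
  exact memLp_one_iff_integrable.1 (hf.mono_exponent hp K hK hKU)

lemma memLpLoc_one_iff : MemLpLoc U 1 f ↔ LocallyIntegrableOn f U := by
  refine ⟨fun h => h.locallyIntegrableOn le_rfl, fun h K hK hKU => ?_⟩
  exact memLp_one_iff_integrable.2 (h.integrableOn_compact_subset hKU hK)

lemma MemLpLoc.memLp_testFunction_mul (hf : MemLpLoc U p f) (φ : 𝓓(U, ℝ)) :
    MemLp (fun x => φ x * f x) p volume := by
  have h := hf _ φ.hasCompactSupport φ.tsupport_subset
  rw [← memLp_indicator_iff_restrict (isClosed_tsupport _).measurableSet] at h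
  convert h.mul (r := p) (φ.memLp_top (μ := volume)) using 1
  ext x
  by_cases hx : x ∈ tsupport φ
  · simp [hx]
  · simp [hx, image_eq_zero_of_notMem_tsupport hx]

end Local

/-! ### Distributions given by functions. -/

section Distributions

variable {U : Opens Plane} {f g : Plane → ℝ}

lemma testFunction_lineDeriv_apply (φ : 𝓓(U, ℝ)) (v x : Plane) :
    (∂_{v} φ : 𝓓(U, ℝ)) x = fderiv ℝ φ x v := by
  rw [TestFunction.lineDerivOp_eq_lineDerivCLM ℝ, TestFunction.lineDerivCLM_apply_of_le (by simp)]
  exact (φ.contDiff.differentiable (by simp)).differentiableAt.lineDeriv_eq_fderiv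

lemma toDist_apply (hf : LocallyIntegrableOn f U) (φ : 𝓓(U, ℝ)) :
    toDist U f φ = ∫ x, φ x * f x := by
  exact TestFunction.integralAgainstBilinCLM_eq_integral hf

lemma lineDeriv_toDist_apply (hf : LocallyIntegrableOn f U) (v : Plane) (φ : 𝓓(U, ℝ)) :
    (∂_{v} (toDist U f)) φ = -∫ x, (∂_{v} φ : 𝓓(U, ℝ)) x * f x := by
  rw [Distribution.lineDerivOp_apply_apply, map_neg, toDist_apply hf]

lemma integrable_testFunction_mul (hf : LocallyIntegrableOn f U) (φ : 𝓓(U, ℝ)) :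
    Integrable fun x => φ x * f x :=
  φ.integrable_bilin (ContinuousLinearMap.mul ℝ ℝ) hf

lemma toDist_congr (h : f =ᵐ[volume.restrict (U : Set Plane)] g) : toDist U f = toDist U g := by
  by_cases hf : LocallyIntegrableOn f U
  · ext φ
    rw [toDist_apply hf, toDist_apply (hf.congr h)]
    refine integral_congr_ae ?_
    rw [Filter.EventuallyEq, ae_restrict_iff' U.isOpen.measurableSet] at h
    filter_upwards [h] with x hx
    by_cases hxU : x ∈ U
    · rw [hx hxU]
    · rw [image_eq_zero_of_notMem_tsupport fun hx => hxU (φ.tsupport_subset hx), zero_mul, zero_mul]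
  -- Neither function is locally integrable, so both sides are the default value zero.
  · have hg : ¬ LocallyIntegrableOn g U := by rwa [← locallyIntegrableOn_congr h]
    unfold toDist
    rw [TestFunction.integralAgainstBilinCLM_eq_zero hf,
      TestFunction.integralAgainstBilinCLM_eq_zero hg]

lemma toDist_add (hf : LocallyIntegrableOn f U) (hg : LocallyIntegrableOn g U) :
    toDist U (fun x => f x + g x) = toDist U f + toDist U g := by
  ext φ
  have h := integral_add (integrable_testFunction_mul hf φ) (integrable_testFunction_mul hg φ)
  simp only [← mul_add] at h
  rw [toDist_apply (f := fun x => f x + g x) (hf.add hg), h]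
  simp [toDist_apply hf, toDist_apply hg]

lemma toDist_zero : toDist U (fun _ => 0) = 0 := by
  ext φ
  rw [toDist_apply locallyIntegrableOn_zero]
  simp

lemma toDist_const_mul (hf : LocallyIntegrableOn f U) (c : ℝ) :
    toDist U (fun x => c * f x) = c • toDist U f := by
  ext φ
  rw [toDist_apply (f := fun x => c * f x) (hf.smul c)]
  simp only [mul_left_comm _ c]
  rw [integral_const_mul]
  simp [toDist_apply hf]

lemma toDist_neg (hf : LocallyIntegrableOn f U) :
    toDist U (fun x => -f x) = -toDist U f := by
  simpa using toDist_const_mul hf (-1)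

lemma toDist_sub (hf : LocallyIntegrableOn f U) (hg : LocallyIntegrableOn g U) :
    toDist U (fun x => f x - g x) = toDist U f - toDist U g := by
  simp only [sub_eq_add_neg]
  rw [toDist_add hf (g := fun x => -g x) hg.neg, toDist_neg hg]

lemma toDist_sum {ι : Type*} (s : Finset ι) {f : ι → Plane → ℝ}
    (hf : ∀ i ∈ s, LocallyIntegrableOn (f i) U) :
    toDist U (fun x => ∑ i ∈ s, f i x) = ∑ i ∈ s, toDist U (f i) := by
  classical
  induction s using Finset.induction_on with
  | empty => simpa using toDist_zero
  | insert a s ha ih =>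
    simp only [Finset.sum_insert ha]
    have hs : ∀ i ∈ s, LocallyIntegrableOn (f i) U := fun i hi => hf i (Finset.mem_insert_of_mem hi)
    rw [toDist_add (g := fun x => ∑ i ∈ s, f i x) (hf a (Finset.mem_insert_self _ _))
      ((MemLpLoc.sum s fun i hi => memLpLoc_one_iff.2 (hs i hi)).locallyIntegrableOn le_rfl),
      ih hs]

/-- The fundamental lemma of the calculus of variations, which makes weak derivatives unique almost
everywhere. -/
lemma ae_eq_of_toDist_eq (hf : LocallyIntegrableOn f U) (hg : LocallyIntegrableOn g U)
    (h : toDist U f = toDist U g) : f =ᵐ[volume.restrict (U : Set Plane)] g := by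
  have key := U.isOpen.ae_eq_zero_of_integral_contDiff_smul_eq_zero (μ := volume)
    (f := fun x => f x - g x) (hf.sub hg) ?_
  · rw [Filter.EventuallyEq, ae_restrict_iff' U.isOpen.measurableSet]
    filter_upwards [key] with x hx hxU
    exact sub_eq_zero.1 (hx hxU)
  · intro φ h1 h2 h3
    rw [← sub_eq_zero, ← toDist_sub hf hg] at h
    have := congrArg (fun T => T (⟨φ, h1, h2, h3⟩ : 𝓓(U, ℝ))) h
    simp only [toDist_apply (f := fun x => f x - g x) (hf.sub hg)] at this
    simpa using this

end Distributions

/-! ### The product rule for curl-type identities. -/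

section Product

open Filter ContinuousLinearMap
open scoped Convolution Topology

variable {U : Opens Plane} {i j : Fin 2} {u ui uj v p q g : Plane → ℝ}

/-- The cutoff `φ` allows extending `u` by zero outside `U` without creating boundary terms, so
mollification commutes with the weak derivative of `φu`. -/
lemma fderiv_convolution_testFunction_mul (hu : IsWeakPartial U i u v) (φ : 𝓓(U, ℝ))
    {ρ : Plane → ℝ} (hρ : ContDiff ℝ ((⊤ : ℕ∞) : WithTop ℕ∞) ρ) (hρs : HasCompactSupport ρ)
    (x : Plane) :
    fderiv ℝ (ρ ⋆[lsmul ℝ ℝ, volume] fun y => φ y * u y) x (e i)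
      = (ρ ⋆[lsmul ℝ ℝ, volume] fun y => φ y * v y + (∂_{e i} φ : 𝓓(U, ℝ)) y * u y) x := by
  obtain ⟨hul, hvl, huv⟩ := hu
  have hρ1 : ContDiff ℝ 1 ρ := hρ.of_le (by exact_mod_cast le_top)
  have hi : Integrable fun y => φ y * u y := integrable_testFunction_mul hul φ
  rw [(hρs.hasFDerivAt_convolution_left (lsmul ℝ ℝ) hρ1 hi.locallyIntegrable x).fderiv]
  have hex := ((hρs.fderiv (𝕜 := ℝ)).convolutionExists_left ((lsmul ℝ ℝ).precompL Plane)
    (hρ1.continuous_fderiv (by simp)) hi.locallyIntegrable x).integrable_swap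
  rw [convolution_eq_swap, ContinuousLinearMap.integral_apply hex, convolution_eq_swap]
  have hsm : ContDiff ℝ ((⊤ : ℕ∞) : WithTop ℕ∞) fun y => ρ (x - y) :=
    hρ.comp (contDiff_const.sub contDiff_id)
  -- For fixed `x` the mollifier times the cutoff is an admissible test function on `U`; testing the
  -- weak derivative identity with it is the whole proof.
  let η : 𝓓(U, ℝ) := ⟨fun y => ρ (x - y) * φ y, hsm.mul φ.contDiff, φ.hasCompactSupport.mul_left,
    (tsupport_mul_subset_right).trans φ.tsupport_subset⟩
  have hη : ∀ y, (∂_{e i} η : 𝓓(U, ℝ)) y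
      = -(fderiv ℝ ρ (x - y) (e i)) * φ y + ρ (x - y) * (∂_{e i} φ : 𝓓(U, ℝ)) y := by
    intro y
    have d1 : HasFDerivAt (fun y => ρ (x - y)) (-(fderiv ℝ ρ (x - y))) y := by
      refine (((hρ1.differentiable (by simp)) (x - y)).hasFDerivAt.comp y
        ((hasFDerivAt_id y).const_sub x)).congr_fderiv ?_
      ext w
      simp
    have d2 := ((φ.contDiff.differentiable (by simp)) y).hasFDerivAt
    rw [testFunction_lineDeriv_apply, testFunction_lineDeriv_apply]
    have : HasFDerivAt η _ y := d1.mul d2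
    rw [this.fderiv]
    simp
    ring
  have h := congrArg (fun T => T η) huv
  simp only [lineDeriv_toDist_apply hul, toDist_apply hvl] at h
  have e1 : ∀ y, ((lsmul ℝ ℝ).precompL Plane (fderiv ℝ ρ (x - y)) (φ y * u y)) (e i)
      = ρ (x - y) * ((∂_{e i} φ : 𝓓(U, ℝ)) y * u y) - (∂_{e i} η : 𝓓(U, ℝ)) y * u y := by
    intro y
    rw [hη]
    simp [ContinuousLinearMap.precompL_apply]
    ring
  have e2 : ∀ y, lsmul ℝ ℝ (ρ (x - y)) (φ y * v y + (∂_{e i} φ : 𝓓(U, ℝ)) y * u y)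
      = ρ (x - y) * ((∂_{e i} φ : 𝓓(U, ℝ)) y * u y) + η y * v y := by
    intro y
    change ρ (x - y) * _ = _ + (ρ (x - y) * φ y) * v y
    ring
  have i1 : Integrable fun y => ρ (x - y) * ((∂_{e i} φ : 𝓓(U, ℝ)) y * u y) :=
    (hρs.convolutionExists_left (lsmul ℝ ℝ) hρ1.continuous
      (integrable_testFunction_mul hul (∂_{e i} φ)).locallyIntegrable x).integrable_swap
  simp only [e1, e2]
  rw [integral_sub i1 (integrable_testFunction_mul hul _),
    integral_add i1 (integrable_testFunction_mul hvl _), ← h]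
  ring

/-- A mollifying sequence. -/
noncomputable def mollifier (n : ℕ) : ContDiffBump (0 : Plane) :=
  ⟨1 / (n + 1), 2 * (1 / (n + 1)), by positivity, by
    have : (0 : ℝ) < 1 / (n + 1) := by positivity
    linarith⟩

lemma tendsto_mollifier_rOut : Tendsto (fun n => (mollifier n).rOut) atTop (𝓝 0) := by
  rw [← mul_zero (2 : ℝ)]
  exact (tendsto_one_div_add_atTop_nhds_zero_nat (𝕜 := ℝ)).const_mul 2

lemma mollifier_rOut_le (n : ℕ) : (mollifier n).rOut ≤ 2 * (mollifier n).rIn := le_rfl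

lemma integral_indicator_mul_of_support {K : Set Plane} {f h : Plane → ℝ}
    (hh : ∀ x, x ∉ K → h x = 0) : ∫ x, K.indicator f x * h x = ∫ x, h x * f x := by
  congr 1
  ext x
  by_cases hx : x ∈ K
  · simp [hx, mul_comm]
  · simp [hx, hh x hx]

lemma tendsto_integral_mollify_mul {f h : Plane → ℝ} {K : Set Plane} (hKc : IsCompact K)
    (hKU : K ⊆ U) (hf : MemLpLoc U 2 f) (hh : MemLp h 2 volume) (hhK : ∀ x, x ∉ K → h x = 0)
    (hs : ∀ᶠ n in atTop, ∀ x, x ∉ K →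
      ((mollifier n).normed volume ⋆[lsmul ℝ ℝ, volume] h) x = 0) :
    Tendsto (fun n => ∫ x, ((mollifier n).normed volume ⋆[lsmul ℝ ℝ, volume] h) x * f x) atTop
      (𝓝 (∫ x, h x * f x)) := by
  have h2 : MemLp (K.indicator f) 2 volume :=
    (memLp_indicator_iff_restrict hKc.measurableSet).2 (hf K hKc hKU)
  have h1 : Integrable (K.indicator f) := (integrable_indicator_iff hKc.measurableSet).2
    (memLp_one_iff_integrable.1 (hf.mono_exponent (by norm_num) K hKc hKU))
  have := tendsto_integral_mul_mollify_of_memLp_two tendsto_mollifier_rOut mollifier_rOut_le h2 h1 hh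
  rw [integral_indicator_mul_of_support hhK] at this
  refine this.congr' ?_
  filter_upwards [hs] with n hn
  exact integral_indicator_mul_of_support hn

lemma tendsto_integral_mollify_mul_of_bounded {f h : Plane → ℝ} {K : Set Plane} {M : ℝ}
    (hKc : IsCompact K) (hKU : K ⊆ U) (hf : LocallyIntegrableOn f U)
    (hh : LocallyIntegrable h) (hM : ∀ᵐ x, |h x| ≤ M) (hhK : ∀ x, x ∉ K → h x = 0)
    (hs : ∀ᶠ n in atTop, ∀ x, x ∉ K →
      ((mollifier n).normed volume ⋆[lsmul ℝ ℝ, volume] h) x = 0) :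
    Tendsto (fun n => ∫ x, ((mollifier n).normed volume ⋆[lsmul ℝ ℝ, volume] h) x * f x) atTop
      (𝓝 (∫ x, h x * f x)) := by
  have h1 : Integrable (K.indicator f) := (integrable_indicator_iff hKc.measurableSet).2
    (hf.integrableOn_compact_subset hKU hKc)
  have := tendsto_integral_mul_mollify_of_bounded tendsto_mollifier_rOut mollifier_rOut_le h1 hh hM
  rw [integral_indicator_mul_of_support hhK] at this
  refine this.congr' ?_
  filter_upwards [hs] with n hn
  exact integral_indicator_mul_of_support hn

/-- The product rule for `∂ᵢ p - ∂ⱼ q` with a factor in `W^{1,2}_loc ∩ L^∞_loc`. -/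
theorem lineDeriv_sub_lineDeriv_mul (hu : MemLpLoc U ∞ u) (hui : IsWeakPartial U i u ui)
    (huj : IsWeakPartial U j u uj) (hui2 : MemLpLoc U 2 ui) (huj2 : MemLpLoc U 2 uj)
    (hp : MemLpLoc U 2 p) (hq : MemLpLoc U 2 q) (hg : LocallyIntegrableOn g U)
    (h : ∂_{e i} (toDist U p) - ∂_{e j} (toDist U q) = toDist U g) :
    ∂_{e i} (toDist U fun x => u x * p x) - ∂_{e j} (toDist U fun x => u x * q x)
      = toDist U fun x => u x * g x + ui x * p x - uj x * q x := by
  have hpl := hp.locallyIntegrableOn (by norm_num)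
  have hql := hq.locallyIntegrableOn (by norm_num)
  have hupl : LocallyIntegrableOn (fun x => u x * p x) U :=
    (hu.mul hp : MemLpLoc U 2 _).locallyIntegrableOn (by norm_num)
  have huql : LocallyIntegrableOn (fun x => u x * q x) U :=
    (hu.mul hq : MemLpLoc U 2 _).locallyIntegrableOn (by norm_num)
  have hugl : LocallyIntegrableOn (fun x => u x * g x) U :=
    memLpLoc_one_iff.1 (hu.mul (memLpLoc_one_iff.2 hg) : MemLpLoc U 1 _)
  have huip : LocallyIntegrableOn (fun x => ui x * p x) U :=
    memLpLoc_one_iff.1 (hui2.mul hp : MemLpLoc U 1 _)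
  have hujq : LocallyIntegrableOn (fun x => uj x * q x) U :=
    memLpLoc_one_iff.1 (huj2.mul hq : MemLpLoc U 1 _)
  ext φ
  rw [toDist_sub (f := fun x => u x * g x + ui x * p x) (hugl.add huip) hujq,
    toDist_add hugl huip]
  simp only [sub_apply, add_apply, lineDeriv_toDist_apply hupl, lineDeriv_toDist_apply huql,
    toDist_apply hugl, toDist_apply huip, toDist_apply hujq]
  -- Room for mollifying: once the mollification radius is below `δ`, the mollified functions are
  -- supported in the compact set `K` inside `U`.
  obtain ⟨δ, hδ, hδU⟩ := φ.hasCompactSupport.isCompact.exists_cthickening_subset_open U.isOpen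
    φ.tsupport_subset
  set K := Metric.cthickening δ (tsupport φ) with hK
  have hKc : IsCompact K := φ.hasCompactSupport.isCompact.cthickening
  have hφK : tsupport φ ⊆ K := Metric.self_subset_cthickening _
  let ψ : Plane → ℝ := fun y => φ y * u y
  have hψs : ∀ x, x ∉ tsupport φ → ψ x = 0 := fun x hx => by
    simp [ψ, image_eq_zero_of_notMem_tsupport hx]
  have hul := hui.1
  have hψi : Integrable ψ := integrable_testFunction_mul hul φ
  have hM := ae_le_lpNorm_exponent_top (hu.memLp_testFunction_mul φ)
  have hu2 : MemLpLoc U 2 u := hu.mono_exponent le_top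
  have hsupp : ∀ᶠ n in atTop, ∀ h : Plane → ℝ, (∀ x, x ∉ tsupport φ → h x = 0) →
      Function.support ((mollifier n).normed volume ⋆[lsmul ℝ ℝ, volume] h) ⊆ K := by
    filter_upwards [tendsto_mollifier_rOut.eventually_lt_const hδ] with n hn h hh
    refine (support_convolution_subset_swap _).trans ?_
    rintro _ ⟨x, hx, y, hy, rfl⟩
    have hx' : x ∈ tsupport φ := by
      by_contra hc
      exact hx (hh x hc)
    rw [ContDiffBump.support_normed_eq, mem_ball_zero_iff] at hy
    refine Metric.mem_cthickening_of_dist_le _ x _ _ hx' ?_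
    simpa [dist_eq_norm] using (hy.trans hn).le
  -- Derivatives of the mollified `φu` converge weakly in `L²`, which suffices because they are
  -- paired with the `L²` functions `p` and `q`.
  have hdψ : ∀ {k : Fin 2} {w : Plane → ℝ}, IsWeakPartial U k u w → MemLpLoc U 2 w →
      ∀ {f : Plane → ℝ}, MemLpLoc U 2 f → Tendsto (fun n => ∫ x, fderiv ℝ
        ((mollifier n).normed volume ⋆[lsmul ℝ ℝ, volume] ψ) x (e k) * f x) atTop
        (𝓝 (∫ x, (φ x * w x + (∂_{e k} φ : 𝓓(U, ℝ)) x * u x) * f x)) := by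
    intro k w hw hw2 f hf
    have hz : ∀ x, x ∉ tsupport φ → φ x * w x + (∂_{e k} φ : 𝓓(U, ℝ)) x * u x = 0 := by
      intro x hx
      rw [testFunction_lineDeriv_apply, image_eq_zero_of_notMem_tsupport hx,
        image_eq_zero_of_notMem_tsupport fun hx' => hx (tsupport_fderiv_subset ℝ hx')]
      simp
    simp only [ψ, fderiv_convolution_testFunction_mul hw φ (mollifier _).contDiff_normed
      (mollifier _).hasCompactSupport_normed]
    refine tendsto_integral_mollify_mul hKc hδU hf ((hw2.memLp_testFunction_mul φ).add
      (hu2.memLp_testFunction_mul _)) (fun x hx => hz x fun hx' => hx (hφK hx')) ?_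
    filter_upwards [hsupp] with n hn x hx
    by_contra hc
    exact hx (hn _ hz hc)
  -- Here `g` is merely integrable, so the boundedness of `φu` is needed.
  have hψt : Tendsto (fun n => ∫ x, ((mollifier n).normed volume ⋆[lsmul ℝ ℝ, volume] ψ) x * g x)
      atTop (𝓝 (∫ x, ψ x * g x)) := by
    refine tendsto_integral_mollify_mul_of_bounded hKc hδU hg hψi.locallyIntegrable hM
      (fun x hx => hψs x fun hx' => hx (hφK hx')) ?_
    filter_upwards [hsupp] with n hn x hx
    by_contra hc
    exact hx (hn _ hψs hc)
  -- For large `n` the mollified `φu` is itself a test function on `U`, so the assumed identity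
  -- applies to it.
  have heq : ∀ᶠ n in atTop,
      -(∫ x, fderiv ℝ ((mollifier n).normed volume ⋆[lsmul ℝ ℝ, volume] ψ) x (e i) * p x)
      + (∫ x, fderiv ℝ ((mollifier n).normed volume ⋆[lsmul ℝ ℝ, volume] ψ) x (e j) * q x)
      = ∫ x, ((mollifier n).normed volume ⋆[lsmul ℝ ℝ, volume] ψ) x * g x := by
    filter_upwards [hsupp] with n hn
    have ht : tsupport ((mollifier n).normed volume ⋆[lsmul ℝ ℝ, volume] ψ) ⊆ K :=
      closure_minimal (hn ψ hψs) hKc.isClosed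
    let Φ : 𝓓(U, ℝ) := ⟨(mollifier n).normed volume ⋆[lsmul ℝ ℝ, volume] ψ,
      (mollifier n).hasCompactSupport_normed.contDiff_convolution_left _
        (mollifier n).contDiff_normed hψi.locallyIntegrable,
      hKc.of_isClosed_subset (isClosed_tsupport _) ht, ht.trans hδU⟩
    have := congrArg (fun T => T Φ) h
    simp only [sub_apply, lineDeriv_toDist_apply hpl, lineDeriv_toDist_apply hql,
      toDist_apply hg, testFunction_lineDeriv_apply] at this
    rw [← sub_neg_eq_add]
    exact this
  have hfin := tendsto_nhds_unique_of_eventuallyEq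
    ((hdψ hui hui2 hp).neg.add (hdψ huj huj2 hq)) hψt heq
  have split : ∀ {k : Fin 2} {w f : Plane → ℝ}, LocallyIntegrableOn (fun x => w x * f x) U →
      LocallyIntegrableOn (fun x => u x * f x) U →
      ∫ x, (φ x * w x + (∂_{e k} φ : 𝓓(U, ℝ)) x * u x) * f x
        = (∫ x, φ x * (w x * f x)) + ∫ x, (∂_{e k} φ : 𝓓(U, ℝ)) x * (u x * f x) := by
    intro k w f h1 h2
    rw [← integral_add (integrable_testFunction_mul h1 φ) (integrable_testFunction_mul h2 _)]
    congr 1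
    ext x
    ring
  rw [split huip hupl, split hujq huql] at hfin
  have e3 : ∫ x, ψ x * g x = ∫ x, φ x * (u x * g x) := by simp only [ψ, mul_assoc]
  rw [e3] at hfin
  linarith

end Product

/-! ### Weak partial derivatives. -/

section WeakPartial

variable {U : Opens Plane} {i j : Fin 2} {f g f' g' u v : Plane → ℝ}

lemma IsWeakPartial.congr (h : IsWeakPartial U i f g)
    (hf : f =ᵐ[volume.restrict (U : Set Plane)] f')
    (hg : g =ᵐ[volume.restrict (U : Set Plane)] g') : IsWeakPartial U i f' g' :=
  ⟨h.1.congr hf, h.2.1.congr hg, by rw [← toDist_congr hf, ← toDist_congr hg, h.2.2]⟩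

lemma IsWeakPartial.ae_eq (h : IsWeakPartial U i f g) (h' : IsWeakPartial U i f g') :
    g =ᵐ[volume.restrict (U : Set Plane)] g' :=
  ae_eq_of_toDist_eq h.2.1 h'.2.1 (h.2.2.symm.trans h'.2.2)

/-- Removes the arbitrary choice of representative in `weakPartial`. -/
lemma IsWeakPartial.weakPartial_ae_eq (h : IsWeakPartial U i f g) :
    weakPartial U i f =ᵐ[volume.restrict (U : Set Plane)] g := by
  have hex : ∃ g, IsWeakPartial U i f g := ⟨g, h⟩
  have : weakPartial U i f = hex.choose := dif_pos hex
  rw [this]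
  exact hex.choose_spec.ae_eq h

lemma MemW12Loc.memLpLoc_weakPartial (h : MemW12Loc U f) (i : Fin 2) :
    MemLpLoc U 2 (weakPartial U i f) := by
  obtain ⟨g, hg, hfg⟩ := h.2 i
  exact hg.congr hfg.weakPartial_ae_eq.symm

lemma MemW12Loc.isWeakPartial (h : MemW12Loc U f) (i : Fin 2) :
    IsWeakPartial U i f (weakPartial U i f) := by
  obtain ⟨g, _, hfg⟩ := h.2 i
  exact hfg.congr .rfl hfg.weakPartial_ae_eq.symm

lemma MemW12Loc.congr (h : MemW12Loc U f) (hf : f =ᵐ[volume.restrict (U : Set Plane)] f') :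
    MemW12Loc U f' :=
  ⟨h.1.congr hf, fun i => ⟨_, h.memLpLoc_weakPartial i, (h.isWeakPartial i).congr hf .rfl⟩⟩

lemma MemW12Loc.weakPartial_congr (h : MemW12Loc U f) (i : Fin 2)
    (hf : f =ᵐ[volume.restrict (U : Set Plane)] f') :
    weakPartial U i f =ᵐ[volume.restrict (U : Set Plane)] weakPartial U i f' :=
  ((h.isWeakPartial i).congr hf .rfl).weakPartial_ae_eq.symm

lemma IsWeakPartial.add (h : IsWeakPartial U i f g) (h' : IsWeakPartial U i f' g') :
    IsWeakPartial U i (fun x => f x + f' x) fun x => g x + g' x := by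
  refine ⟨h.1.add h'.1, h.2.1.add h'.2.1, ?_⟩
  rw [toDist_add h.1 h'.1, toDist_add h.2.1 h'.2.1, LineDeriv.lineDerivOp_add, h.2.2, h'.2.2]

lemma isWeakPartial_const (c : ℝ) : IsWeakPartial U i (fun _ => c) fun _ => 0 := by
  refine ⟨locallyIntegrableOn_const c, locallyIntegrableOn_zero, ?_⟩
  ext φ
  rw [lineDeriv_toDist_apply (locallyIntegrableOn_const c), toDist_zero]
  simp only [testFunction_lineDeriv_apply]
  have h1 : LocallyIntegrableOn (fun _ : Plane => (1 : ℝ)) U := locallyIntegrableOn_const 1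
  have i1 := integrable_testFunction_mul h1 φ
  have i2 := integrable_testFunction_mul h1 (∂_{e i} φ)
  simp only [testFunction_lineDeriv_apply, mul_one] at i1 i2
  have := integral_mul_fderiv_eq_neg_fderiv_mul_of_integrable (μ := volume) (v := e i)
    (f := fun _ : Plane => (1 : ℝ)) (g := φ) (by simp) (by simpa using i2) (by simpa using i1)
    (fun _ _ => differentiableAt_const _) (fun x _ => φ.contDiff.differentiable (by simp) x)
  simp only [one_mul, fderiv_fun_const, Pi.zero_apply, zero_apply, zero_mul,
    integral_zero, neg_zero] at this
  rw [integral_mul_const, this]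
  simp

lemma testFunction_lineDeriv_comm (φ : 𝓓(U, ℝ)) (v w : Plane) :
    (∂_{v} (∂_{w} φ : 𝓓(U, ℝ)) : 𝓓(U, ℝ)) = ∂_{w} (∂_{v} φ : 𝓓(U, ℝ)) := by
  have h2 : ContDiff ℝ 2 φ := contDiff_infty.1 φ.contDiff 2
  have key : ∀ (a b x : Plane), (∂_{a} (∂_{b} φ : 𝓓(U, ℝ)) : 𝓓(U, ℝ)) x
      = fderiv ℝ (fderiv ℝ φ) x a b := by
    intro a b x
    rw [testFunction_lineDeriv_apply]
    have e : ((∂_{b} φ : 𝓓(U, ℝ)) : Plane → ℝ) = fun y => fderiv ℝ φ y b := by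
      ext y
      exact testFunction_lineDeriv_apply φ b y
    have hd : DifferentiableAt ℝ (fderiv ℝ φ) x :=
      ((h2.fderiv_right (m := 1) (by norm_num)).differentiable (by simp)) x
    rw [e, fderiv_clm_apply hd (differentiableAt_const b)]
    simp
  ext x
  rw [key, key]
  exact (h2.contDiffAt.isSymmSndFDerivAt (by simp)).eq v w

lemma distribution_lineDeriv_comm (T : 𝓓'(U, ℝ)) (v w : Plane) :
    (∂_{v} (∂_{w} T : 𝓓'(U, ℝ)) : 𝓓'(U, ℝ)) = ∂_{w} (∂_{v} T : 𝓓'(U, ℝ)) := by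
  ext φ
  simp only [Distribution.lineDerivOp_apply_apply, map_neg, neg_neg]
  rw [testFunction_lineDeriv_comm]

lemma MemW12Loc.lineDeriv_weakPartial_comm (h : MemW12Loc U f) (i j : Fin 2) :
    ∂_{e i} (toDist U (weakPartial U j f)) = ∂_{e j} (toDist U (weakPartial U i f)) := by
  rw [← (h.isWeakPartial i).2.2, ← (h.isWeakPartial j).2.2, distribution_lineDeriv_comm]

end WeakPartial

/-! ### The algebra of locally bounded Sobolev functions. -/

/-- `f ∈ W^{1,2}_loc(U) ∩ L^∞_loc(U)`. -/
structure MemWB (U : Opens Plane) (f : Plane → ℝ) : Prop where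
  memW12Loc : MemW12Loc U f
  memLpLoc_top : MemLpLoc U ∞ f

section Algebra

variable {U : Opens Plane} {i j : Fin 2} {f g f' g' u v : Plane → ℝ}

lemma MemWB.of_isWeakPartial (hu : MemLpLoc U ∞ u) {d : Fin 2 → Plane → ℝ}
    (hd : ∀ i, IsWeakPartial U i u (d i)) (hd2 : ∀ i, MemLpLoc U 2 (d i)) : MemWB U u :=
  ⟨⟨hu.mono_exponent le_top, fun i => ⟨d i, hd2 i, hd i⟩⟩, hu⟩

lemma MemWB.congr (h : MemWB U f) (hf : f =ᵐ[volume.restrict (U : Set Plane)] g) : MemWB U g :=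
  ⟨h.1.congr hf, h.2.congr hf⟩

lemma MemWB.isWeakPartial (h : MemWB U f) (i : Fin 2) :
    IsWeakPartial U i f (weakPartial U i f) := h.1.isWeakPartial i

lemma MemWB.memLpLoc_weakPartial (h : MemWB U f) (i : Fin 2) :
    MemLpLoc U 2 (weakPartial U i f) := h.1.memLpLoc_weakPartial i

lemma memWB_const (c : ℝ) : MemWB U fun _ => c :=
  .of_isWeakPartial (memLpLoc_const c) (fun _ => isWeakPartial_const c) fun _ => memLpLoc_const 0

lemma MemWB.add (hu : MemWB U u) (hv : MemWB U v) : MemWB U fun x => u x + v x :=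
  .of_isWeakPartial (hu.2.add hv.2) (fun i => (hu.isWeakPartial i).add (hv.isWeakPartial i))
    fun i => (hu.memLpLoc_weakPartial i).add (hv.memLpLoc_weakPartial i)

/-- The case `p = v`, `q = 0` of the curl-type product rule. -/
lemma MemWB.isWeakPartial_mul (hu : MemWB U u) (hv : MemWB U v) (i : Fin 2) :
    IsWeakPartial U i (fun x => u x * v x)
      fun x => u x * weakPartial U i v x + weakPartial U i u x * v x := by
  have hvd := hv.memLpLoc_weakPartial i
  have hud := hu.memLpLoc_weakPartial i
  refine ⟨(hu.2.mul hv.2 : MemLpLoc U ∞ _).locallyIntegrableOn le_top,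
    ((hu.2.mul hvd : MemLpLoc U 2 _).add (hud.mul hv.2)).locallyIntegrableOn (by norm_num), ?_⟩
  have := lineDeriv_sub_lineDeriv_mul (q := fun _ => 0) hu.2 (hu.isWeakPartial i)
    (hu.isWeakPartial i) hud hud hv.1.1 (memLpLoc_const 0) (hv.isWeakPartial i).2.1
    (by rw [(hv.isWeakPartial i).2.2, toDist_zero, LineDeriv.lineDerivOp_zero, sub_zero])
  simpa only [mul_zero, toDist_zero, LineDeriv.lineDerivOp_zero, sub_zero] using this

lemma MemWB.mul (hu : MemWB U u) (hv : MemWB U v) : MemWB U fun x => u x * v x :=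
  .of_isWeakPartial (hu.2.mul hv.2) (fun i => hu.isWeakPartial_mul hv i) fun i =>
    (hu.2.mul (hv.memLpLoc_weakPartial i)).add ((hu.memLpLoc_weakPartial i).mul hv.2)

lemma MemWB.neg (hu : MemWB U u) : MemWB U fun x => -u x := by
  simpa using (memWB_const (-1)).mul hu

lemma MemWB.sub (hu : MemWB U u) (hv : MemWB U v) : MemWB U fun x => u x - v x := by
  simpa only [sub_eq_add_neg] using hu.add hv.neg

lemma MemWB.sum {ι : Type*} (s : Finset ι) {f : ι → Plane → ℝ}
    (hf : ∀ i ∈ s, MemWB U (f i)) : MemWB U fun x => ∑ i ∈ s, f i x := by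
  classical
  induction s using Finset.induction_on with
  | empty => simpa using memWB_const 0
  | insert a s ha ih =>
    simp only [Finset.sum_insert ha]
    exact (hf a (Finset.mem_insert_self _ _)).add
      (ih fun i hi => hf i (Finset.mem_insert_of_mem hi))

lemma isWeakPartial_sum {ι : Type*} (s : Finset ι) {f d : ι → Plane → ℝ}
    (hf : ∀ k ∈ s, IsWeakPartial U i (f k) (d k)) :
    IsWeakPartial U i (fun x => ∑ k ∈ s, f k x) fun x => ∑ k ∈ s, d k x := by
  classical
  induction s using Finset.induction_on with
  | empty => simpa using isWeakPartial_const 0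
  | insert a s ha ih =>
    simp only [Finset.sum_insert ha]
    exact (hf a (Finset.mem_insert_self _ _)).add
      (ih fun i hi => hf i (Finset.mem_insert_of_mem hi))

end Algebra

/-! ### The chain rule. -/

section Chain

variable {U : Opens Plane} {u : Plane → ℝ}

open Polynomial in
lemma exists_derivative_eq (Q : ℝ[X]) : ∃ P : ℝ[X], derivative P = Q := by
  induction Q using Polynomial.induction_on' with
  | add p q hp hq =>
    obtain ⟨P, rfl⟩ := hp
    obtain ⟨Q, rfl⟩ := hq
    exact ⟨P + Q, derivative_add⟩
  | monomial n a =>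
    refine ⟨monomial (n + 1) (a / (n + 1)), ?_⟩
    rw [derivative_monomial]
    congr 1
    push_cast
    field_simp

open Polynomial in
/-- Approximation of a continuously differentiable function by polynomials in `C¹`. -/
lemma exists_polynomial_near_deriv {F F' : ℝ → ℝ} {c M ε : ℝ} (hcM : c ≤ M)
    (hF : ∀ t ∈ Set.Icc c M, HasDerivAt F (F' t) t) (hF' : ContinuousOn F' (Set.Icc c M))
    (hε : 0 < ε) :
    ∃ P : ℝ[X], ∀ t ∈ Set.Icc c M,
      |F t - P.eval t| ≤ ε * (M - c) ∧ |F' t - (derivative P).eval t| ≤ ε := by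
  obtain ⟨Q, hQ⟩ := exists_polynomial_near_of_continuousOn c M F' hF' ε hε
  obtain ⟨P, rfl⟩ := exists_derivative_eq Q
  -- The constant makes the polynomial agree with `F` at `c`, so the mean value inequality turns the
  -- bound on derivatives into one on values.
  refine ⟨P + C (F c - P.eval c), fun t ht => ?_⟩
  have hd : ∀ t ∈ Set.Icc c M, |F' t - (derivative P).eval t| ≤ ε := fun t ht => by
    rw [abs_sub_comm]
    exact (hQ t ht).le
  refine ⟨?_, by simpa using hd t ht⟩
  have := (convex_Icc c M).norm_image_sub_le_of_norm_hasDerivWithin_le (f := fun t => F t - P.eval t)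
    (fun s hs => ((hF s hs).sub (P.hasDerivAt s)).hasDerivWithinAt)
    (fun s hs => hd s hs) (Set.left_mem_Icc.2 hcM) ht
  rw [Real.norm_eq_abs, Real.norm_eq_abs, abs_of_nonneg (sub_nonneg.2 ht.1)] at this
  have e : F t - (P + C (F c - P.eval c)).eval t = F t - P.eval t - (F c - P.eval c) := by
    simp only [eval_add, eval_C]
    ring
  rw [e]
  exact this.trans (mul_le_mul_of_nonneg_left (by linarith [ht.2]) hε.le)

open Polynomial in
lemma MemWB.polynomial_eval (hu : MemWB U u) (P : ℝ[X]) : MemWB U (fun x => P.eval (u x)) ∧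
    ∀ i, IsWeakPartial U i (fun x => P.eval (u x))
      fun x => (derivative P).eval (u x) * weakPartial U i u x := by
  induction P using Polynomial.induction_on with
  | C a => simpa using ⟨memWB_const a, isWeakPartial_const a, isWeakPartial_const a⟩
  | add p q hp hq =>
    simp only [eval_add, derivative_add, add_mul]
    exact ⟨hp.1.add hq.1, fun i => (hp.2 i).add (hq.2 i)⟩
  | monomial n a ih =>
    rw [pow_succ, ← mul_assoc]
    generalize C a * X ^ n = p at ih
    simp only [derivative_mul, eval_mul, eval_X, derivative_X, eval_add, mul_one]
    refine ⟨ih.1.mul hu, fun i => (ih.1.isWeakPartial_mul hu i).congr .rfl ?_⟩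
    filter_upwards [(ih.2 i).weakPartial_ae_eq] with x hx
    rw [hx]
    ring

lemma MemLpLoc.comp_of_continuousOn {F : ℝ → ℝ} (hu : MemLpLoc U ∞ u)
    (hF : ContinuousOn F (Set.Ioi 0)) (hFm : Measurable F)
    (hpos : ∀ K : Set Plane, IsCompact K → K ⊆ U →
      ∃ c : ℝ, 0 < c ∧ ∀ᵐ x ∂volume.restrict K, c ≤ u x) :
    MemLpLoc U ∞ fun x => F (u x) := by
  intro K hK hKU
  obtain ⟨c, hc, hcu⟩ := hpos K hK hKU
  have hM := ae_le_lpNorm_exponent_top (hu K hK hKU)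
  set M := lpNorm u ∞ (volume.restrict K)
  obtain ⟨B, hB⟩ := (isCompact_Icc (a := c) (b := M)).exists_bound_of_continuousOn
    (hF.mono fun t ht => hc.trans_le ht.1)
  refine memLp_top_of_bound (hFm.comp_aemeasurable (hu K hK hKU).1.aemeasurable).aestronglyMeasurable
    B ?_
  filter_upwards [hcu, hM] with x h1 h2
  exact hB _ ⟨h1, (le_abs_self _).trans h2⟩

/-- The chain rule for functions in `W^{1,2}_loc ∩ L^∞_loc` that are locally bounded away
from zero. -/
theorem MemWB.comp (hu : MemWB U u) {F F' : ℝ → ℝ} (hF : ∀ t, 0 < t → HasDerivAt F (F' t) t)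
    (hF' : ContinuousOn F' (Set.Ioi 0)) (hFm : Measurable F) (hFm' : Measurable F')
    (hpos : ∀ K : Set Plane, IsCompact K → K ⊆ U →
      ∃ c : ℝ, 0 < c ∧ ∀ᵐ x ∂volume.restrict K, c ≤ u x) :
    MemWB U fun x => F (u x) := by
  have hFc : ContinuousOn F (Set.Ioi 0) := fun t ht => (hF t ht).continuousAt.continuousWithinAt
  have b1 := hu.2.comp_of_continuousOn hFc hFm hpos
  have b2 := hu.2.comp_of_continuousOn hF' hFm' hpos
  have b3 : ∀ i, MemLpLoc U 2 fun x => F' (u x) * weakPartial U i u x := fun i =>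
    b2.mul (hu.memLpLoc_weakPartial i)
  refine .of_isWeakPartial b1 (fun i => ⟨b1.locallyIntegrableOn le_top,
    (b3 i).locallyIntegrableOn (by norm_num), ?_⟩) b3
  have l1 := b1.locallyIntegrableOn le_top
  have l2 := (b3 i).locallyIntegrableOn (by norm_num)
  have l3 := (hu.memLpLoc_weakPartial i).locallyIntegrableOn (by norm_num)
  ext φ
  rw [lineDeriv_toDist_apply l1, toDist_apply l2]
  set K := tsupport φ
  have hK : IsCompact K := φ.hasCompactSupport
  obtain ⟨c, hc, hcu⟩ := hpos K hK φ.tsupport_subset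
  have hM := ae_le_lpNorm_exponent_top (hu.2 K hK φ.tsupport_subset)
  -- The maximum ensures `c ≤ M` even when `K` is a null set and the norm is zero.
  set M := max c (lpNorm u ∞ (volume.restrict K))
  have hrange : ∀ᵐ x, x ∈ K → u x ∈ Set.Icc c M := by
    rw [← ae_restrict_iff' (isClosed_tsupport _).measurableSet]
    filter_upwards [hcu, hM] with x h1 h2
    exact ⟨h1, ((le_abs_self _).trans h2).trans (le_max_right _ _)⟩
  set B := ∫ x, |(∂_{e i} φ : 𝓓(U, ℝ)) x|
  set D := ∫ x, |φ x * weakPartial U i u x|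
  have iB : Integrable fun x => |(∂_{e i} φ : 𝓓(U, ℝ)) x| := by
    simpa using (integrable_testFunction_mul (f := fun _ => (1 : ℝ)) (locallyIntegrableOn_const 1)
      (∂_{e i} φ : 𝓓(U, ℝ))).abs
  have iD : Integrable fun x => |φ x * weakPartial U i u x| :=
    (integrable_testFunction_mul l3 φ).abs
  set Y := (∫ x, (∂_{e i} φ : 𝓓(U, ℝ)) x * F (u x)) + ∫ x, φ x * (F' (u x) * weakPartial U i u x)
    with hY
  -- For a polynomial in place of `F` the two integrals in `Y` cancel exactly, so `Y` consists only
  -- of approximation errors on the range `[c, M]` of `u` over the support of `φ`.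
  have bound : ∀ ε > 0, |Y| ≤ ε * ((M - c) * B + D) := by
    intro ε hε
    obtain ⟨P, hP⟩ := exists_polynomial_near_deriv (le_max_left _ _ : c ≤ M)
      (fun t ht => hF t (hc.trans_le ht.1)) (hF'.mono fun t ht => hc.trans_le ht.1) hε
    obtain ⟨w1, w2, w3⟩ := (hu.polynomial_eval P).2 i
    have h := congrArg (fun T => T φ) w3
    simp only [lineDeriv_toDist_apply w1, toDist_apply w2] at h
    have j1 := (integrable_testFunction_mul l1 (∂_{e i} φ)).sub
      (integrable_testFunction_mul w1 (∂_{e i} φ))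
    have j2 := (integrable_testFunction_mul l2 φ).sub (integrable_testFunction_mul w2 φ)
    have hY2 : Y = (∫ x, ((∂_{e i} φ : 𝓓(U, ℝ)) x * F (u x) -
          (∂_{e i} φ : 𝓓(U, ℝ)) x * P.eval (u x)))
        + ∫ x, (φ x * (F' (u x) * weakPartial U i u x)
          - φ x * (P.derivative.eval (u x) * weakPartial U i u x)) := by
      rw [integral_sub (integrable_testFunction_mul l1 _) (integrable_testFunction_mul w1 _),
        integral_sub (integrable_testFunction_mul l2 _) (integrable_testFunction_mul w2 _), ← h, hY]
      ring
    have e1 : |∫ x, ((∂_{e i} φ : 𝓓(U, ℝ)) x * F (u x) -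
        (∂_{e i} φ : 𝓓(U, ℝ)) x * P.eval (u x))| ≤ ε * (M - c) * B := by
      rw [← integral_const_mul, ← Real.norm_eq_abs]
      refine norm_integral_le_of_norm_le (iB.const_mul _) ?_
      filter_upwards [hrange] with x hx
      rw [← mul_sub, norm_mul, Real.norm_eq_abs, Real.norm_eq_abs, mul_comm]
      by_cases hxK : x ∈ K
      · exact mul_le_mul_of_nonneg_right (hP _ (hx hxK)).1 (abs_nonneg _)
      · rw [testFunction_lineDeriv_apply,
          image_eq_zero_of_notMem_tsupport fun hx' => hxK (tsupport_fderiv_subset ℝ hx')]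
        simp
    have e2 : |∫ x, (φ x * (F' (u x) * weakPartial U i u x)
        - φ x * (P.derivative.eval (u x) * weakPartial U i u x))| ≤ ε * D := by
      rw [← integral_const_mul, ← Real.norm_eq_abs]
      refine norm_integral_le_of_norm_le (iD.const_mul _) ?_
      filter_upwards [hrange] with x hx
      have e : φ x * (F' (u x) * weakPartial U i u x)
          - φ x * (P.derivative.eval (u x) * weakPartial U i u x)
          = (F' (u x) - P.derivative.eval (u x)) * (φ x * weakPartial U i u x) := by ring
      rw [e, norm_mul, Real.norm_eq_abs, Real.norm_eq_abs]
      by_cases hxK : x ∈ K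
      · exact mul_le_mul_of_nonneg_right (hP _ (hx hxK)).2 (abs_nonneg _)
      · simp [image_eq_zero_of_notMem_tsupport hxK]
    calc |Y| ≤ ε * (M - c) * B + ε * D := by
          rw [hY2]
          exact (abs_add_le _ _).trans (add_le_add e1 e2)
      _ = ε * ((M - c) * B + D) := by ring
  have hY0 : Y = 0 := by
    have hC : 0 ≤ (M - c) * B + D := by
      have := bound 1 one_pos
      rw [one_mul] at this
      exact (abs_nonneg _).trans this
    by_contra hne
    have hpY : 0 < |Y| := abs_pos.2 hne
    -- With this `ε` the bound would give `|Y| ≤ |Y| / 2`.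
    have := bound (|Y| / (2 * ((M - c) * B + D + 1))) (by positivity)
    rw [div_mul_eq_mul_div, le_div_iff₀ (by positivity)] at this
    nlinarith
  linarith

lemma MemWB.inv_sqrt (hu : MemWB U u) (hpos : ∀ K : Set Plane, IsCompact K → K ⊆ U →
      ∃ c : ℝ, 0 < c ∧ ∀ᵐ x ∂volume.restrict K, c ≤ u x) :
    MemWB U fun x => (√(u x))⁻¹ := by
  refine hu.comp (F := fun t => (√t)⁻¹) (F' := fun t => -(1 / (2 * √t)) / (√t) ^ 2)
    (fun t ht => ?_) ?_ (by fun_prop) (by fun_prop) hpos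
  · exact (Real.hasDerivAt_sqrt ht.ne').inv (Real.sqrt_pos.2 ht).ne'
  · refine ContinuousOn.div ?_ (by fun_prop) fun t ht => (pow_pos (Real.sqrt_pos.2 ht) 2).ne'
    refine (ContinuousOn.div continuousOn_const (by fun_prop) fun t ht => ?_).neg
    exact (mul_pos two_pos (Real.sqrt_pos.2 ht)).ne'

end Chain

/-! ### Curl equations for matrix fields. -/

section MatrixFields

open Matrix

variable {n : Type*}

/-- Entrywise `L^p_loc` matrix fields. -/
def MatMemLpLoc (U : Opens Plane) (p : ℝ≥0∞) (M : Plane → Matrix n n ℝ) : Prop :=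
  ∀ r s, MemLpLoc U p fun x => M x r s

/-- Entrywise `W^{1,2}_loc ∩ L^∞_loc` matrix fields. -/
def MatMemWB (U : Opens Plane) (M : Plane → Matrix n n ℝ) : Prop :=
  ∀ r s, MemWB U fun x => M x r s

/-- The entrywise weak partial derivative of a matrix field. -/
noncomputable def matWeakPartial (U : Opens Plane) (i : Fin 2) (H : Plane → Matrix n n ℝ)
    (x : Plane) : Matrix n n ℝ :=
  Matrix.of fun r s => weakPartial U i (fun y => H y r s) x

/-- `∂ᵢ Mⱼ - ∂ⱼ Mᵢ = R` in the sense of distributions. -/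
def HasCurl (U : Opens Plane) (i j : Fin 2) (Mi Mj R : Plane → Matrix n n ℝ) : Prop :=
  ∀ r s, ∂_{e i} (toDist U fun x => Mj x r s) - ∂_{e j} (toDist U fun x => Mi x r s)
    = toDist U fun x => R x r s

variable {U : Opens Plane} {i j : Fin 2} {p q t : ℝ≥0∞}
  {M N Mi Mj Mi' Mj' R R' H H' : Plane → Matrix n n ℝ}

lemma ae_apply_eq (h : M =ᵐ[volume.restrict (U : Set Plane)] N) (r s : n) :
    (fun x => M x r s) =ᵐ[volume.restrict (U : Set Plane)] fun x => N x r s := by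
  filter_upwards [h] with x hx
  rw [hx]

lemma MatMemLpLoc.add (hM : MatMemLpLoc U p M) (hN : MatMemLpLoc U p N) :
    MatMemLpLoc U p fun x => M x + N x := fun r s => (hM r s).add (hN r s)

lemma MatMemLpLoc.sub (hM : MatMemLpLoc U p M) (hN : MatMemLpLoc U p N) :
    MatMemLpLoc U p fun x => M x - N x := fun r s => (hM r s).sub (hN r s)

lemma MatMemLpLoc.transpose (hM : MatMemLpLoc U p M) : MatMemLpLoc U p fun x => (M x)ᵀ :=
  fun r s => hM s r

lemma MatMemWB.memLpLoc_top (hM : MatMemWB U M) : MatMemLpLoc U ∞ M := fun r s => (hM r s).2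

lemma MatMemWB.matWeakPartial (hM : MatMemWB U M) (i : Fin 2) :
    MatMemLpLoc U 2 (matWeakPartial U i M) := fun r s => (hM r s).memLpLoc_weakPartial i

lemma MatMemWB.transpose (hM : MatMemWB U M) : MatMemWB U fun x => (M x)ᵀ :=
  fun r s => hM s r

lemma HasCurl.congr (h : HasCurl U i j Mi Mj R) (hi : Mi =ᵐ[volume.restrict (U : Set Plane)] Mi')
    (hj : Mj =ᵐ[volume.restrict (U : Set Plane)] Mj')
    (hR : R =ᵐ[volume.restrict (U : Set Plane)] R') : HasCurl U i j Mi' Mj' R' := fun r s => by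
  rw [← toDist_congr (ae_apply_eq hi r s), ← toDist_congr (ae_apply_eq hj r s),
    ← toDist_congr (ae_apply_eq hR r s), h r s]

lemma hasCurl_congr (hi : Mi =ᵐ[volume.restrict (U : Set Plane)] Mi')
    (hj : Mj =ᵐ[volume.restrict (U : Set Plane)] Mj')
    (hR : R =ᵐ[volume.restrict (U : Set Plane)] R') :
    HasCurl U i j Mi Mj R ↔ HasCurl U i j Mi' Mj' R' :=
  ⟨fun h => h.congr hi hj hR, fun h => h.congr hi.symm hj.symm hR.symm⟩

lemma hasCurl_transpose_iff :
    HasCurl U i j (fun x => (Mi x)ᵀ) (fun x => (Mj x)ᵀ) (fun x => (R x)ᵀ) ↔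
      HasCurl U i j Mi Mj R := ⟨fun h r s => h s r, fun h r s => h s r⟩

/-- A gradient has zero curl, since distributional derivatives commute. -/
lemma hasCurl_sub_matWeakPartial_iff (hH : MatMemWB U H) (hMi : MatMemLpLoc U 2 Mi)
    (hMj : MatMemLpLoc U 2 Mj) :
    HasCurl U i j (fun x => Mi x - matWeakPartial U i H x)
      (fun x => Mj x - matWeakPartial U j H x) R ↔ HasCurl U i j Mi Mj R := by
  refine forall_congr' fun r => forall_congr' fun s => ?_
  have l : ∀ {k : Fin 2} {M : Plane → Matrix n n ℝ}, MatMemLpLoc U 2 M →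
      toDist U (fun x => (M x - matWeakPartial U k H x) r s)
        = toDist U (fun x => M x r s) - toDist U (weakPartial U k fun y => H y r s) :=
    fun hM => toDist_sub ((hM r s).locallyIntegrableOn (by norm_num))
      (((hH r s).memLpLoc_weakPartial _).locallyIntegrableOn (by norm_num))
  rw [l hMi, l hMj]
  simp only [sub_eq_add_neg, LineDeriv.lineDerivOp_add, LineDeriv.lineDerivOp_neg]
  simp only [← sub_eq_add_neg]
  rw [(hH r s).1.lineDeriv_weakPartial_comm i j, sub_sub_sub_cancel_right]

variable [Fintype n]

lemma MatMemLpLoc.mul [ENNReal.HolderTriple p q t] (hM : MatMemLpLoc U p M)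
    (hN : MatMemLpLoc U q N) : MatMemLpLoc U t fun x => M x * N x := fun r s => by
  simp only [mul_apply]
  exact MemLpLoc.sum _ fun k _ => (hM r k).mul (hN k s)

lemma matWeakPartial_congr (hM : MatMemWB U M) (i : Fin 2)
    (h : M =ᵐ[volume.restrict (U : Set Plane)] N) :
    matWeakPartial U i M =ᵐ[volume.restrict (U : Set Plane)] matWeakPartial U i N := by
  have : ∀ r s, ∀ᵐ x ∂volume.restrict (U : Set Plane),
      weakPartial U i (fun y => M y r s) x = weakPartial U i (fun y => N y r s) x := fun r s =>
    (hM r s).1.weakPartial_congr i (ae_apply_eq h r s)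
  filter_upwards [Filter.eventually_all.2 fun r => Filter.eventually_all.2 (this r)] with x hx
  ext r s
  exact hx r s

lemma MatMemWB.mul (hM : MatMemWB U M) (hN : MatMemWB U N) : MatMemWB U fun x => M x * N x :=
  fun r s => by
    simp only [mul_apply]
    exact MemWB.sum _ fun k _ => (hM r k).mul (hN k s)

lemma matWeakPartial_mul (hM : MatMemWB U M) (hN : MatMemWB U N) (i : Fin 2) :
    matWeakPartial U i (fun x => M x * N x) =ᵐ[volume.restrict (U : Set Plane)]
      fun x => M x * matWeakPartial U i N x + matWeakPartial U i M x * N x := by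
  have : ∀ r s, ∀ᵐ x ∂volume.restrict (U : Set Plane),
      weakPartial U i (fun y => (M y * N y) r s) x
        = ∑ k, (M x r k * weakPartial U i (fun y => N y k s) x
          + weakPartial U i (fun y => M y r k) x * N x k s) := fun r s =>
    (isWeakPartial_sum Finset.univ fun k _ =>
      (hM r k).isWeakPartial_mul (hN k s) i).weakPartial_ae_eq
  filter_upwards [Filter.eventually_all.2 fun r => Filter.eventually_all.2 (this r)] with x hx
  ext r s
  rw [Matrix.add_apply, mul_apply, mul_apply, ← Finset.sum_add_distrib]
  exact hx r s

lemma HasCurl.mul_left (h : HasCurl U i j Mi Mj R) (hH : MatMemWB U H)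
    (hMi : MatMemLpLoc U 2 Mi) (hMj : MatMemLpLoc U 2 Mj) (hR : MatMemLpLoc U 1 R) :
    HasCurl U i j (fun x => H x * Mi x) (fun x => H x * Mj x)
      fun x => H x * R x + matWeakPartial U i H x * Mj x - matWeakPartial U j H x * Mi x := by
  intro r s
  have lM : ∀ {M : Plane → Matrix n n ℝ}, MatMemLpLoc U 2 M → ∀ k ∈ Finset.univ,
      LocallyIntegrableOn (fun x => H x r k * M x k s) U := fun hM k _ =>
    ((hH r k).2.mul (hM k s) : MemLpLoc U 2 _).locallyIntegrableOn (by norm_num)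
  have lR : ∀ k, MemLpLoc U 1 fun x => H x r k * R x k s := fun k => (hH r k).2.mul (hR k s)
  have ld : ∀ (l : Fin 2) {M : Plane → Matrix n n ℝ}, MatMemLpLoc U 2 M → ∀ k,
      MemLpLoc U 1 fun x => weakPartial U l (fun y => H y r k) x * M x k s := fun l _ hM k =>
    ((hH r k).memLpLoc_weakPartial l).mul (hM k s)
  simp only [mul_apply, Matrix.add_apply, Matrix.sub_apply]
  rw [toDist_sum _ (lM hMi), toDist_sum _ (lM hMj), LineDeriv.lineDerivOp_sum,
    LineDeriv.lineDerivOp_sum, ← Finset.sum_sub_distrib]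
  have : ∀ x, (∑ k, H x r k * R x k s + ∑ k, matWeakPartial U i H x r k * Mj x k s)
      - ∑ k, matWeakPartial U j H x r k * Mi x k s
      = ∑ k, (H x r k * R x k s + weakPartial U i (fun y => H y r k) x * Mj x k s
        - weakPartial U j (fun y => H y r k) x * Mi x k s) := fun x => by
    rw [← Finset.sum_add_distrib, ← Finset.sum_sub_distrib]
    rfl
  simp only [this]
  rw [toDist_sum _ fun k _ => memLpLoc_one_iff.1 (((lR k).add (ld i hMj k)).sub (ld j hMi k))]
  refine Finset.sum_congr rfl fun k _ => ?_
  exact lineDeriv_sub_lineDeriv_mul (hH r k).2 ((hH r k).isWeakPartial i) ((hH r k).isWeakPartial j)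
    ((hH r k).memLpLoc_weakPartial i) ((hH r k).memLpLoc_weakPartial j) (hMj k s) (hMi k s)
    (memLpLoc_one_iff.1 (hR k s)) (h k s)

variable [DecidableEq n]

lemma mul_matWeakPartial_add (hM : MatMemWB U M) (hN : MatMemWB U N)
    (h : ∀ᵐ x ∂volume.restrict (U : Set Plane), M x * N x = 1) (i : Fin 2) :
    ∀ᵐ x ∂volume.restrict (U : Set Plane),
      M x * matWeakPartial U i N x + matWeakPartial U i M x * N x = 0 := by
  have h1 : ∀ r s, ∀ᵐ x ∂volume.restrict (U : Set Plane),
      weakPartial U i (fun y => (1 : Matrix n n ℝ) r s) x = 0 := fun r s =>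
    (isWeakPartial_const _).weakPartial_ae_eq
  filter_upwards [matWeakPartial_mul hM hN i,
    matWeakPartial_congr (N := fun _ => 1) (hM.mul hN) i h,
    Filter.eventually_all.2 fun r => Filter.eventually_all.2 (h1 r)] with x h2 h3 h4
  rw [← h2, h3]
  ext r s
  exact h4 r s

/-- Multiplication on the left by an invertible matrix field. -/
lemma hasCurl_mul_left_iff (hH : MatMemWB U H) (hH' : MatMemWB U H')
    (hinv : ∀ᵐ x ∂volume.restrict (U : Set Plane), H' x * H x = 1)
    (hMi : MatMemLpLoc U 2 Mi) (hMj : MatMemLpLoc U 2 Mj) (hR : MatMemLpLoc U 1 R) :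
    HasCurl U i j (fun x => H x * Mi x) (fun x => H x * Mj x)
      (fun x => H x * R x + matWeakPartial U i H x * Mj x - matWeakPartial U j H x * Mi x) ↔
    HasCurl U i j Mi Mj R := by
  refine ⟨fun h => ?_, fun h => h.mul_left hH hMi hMj hR⟩
  have h2 := h.mul_left hH' (hH.memLpLoc_top.mul hMi) (hH.memLpLoc_top.mul hMj)
    (((hH.memLpLoc_top.mul hR).add ((hH.matWeakPartial i).mul hMj)).sub
      ((hH.matWeakPartial j).mul hMi))
  -- After multiplying back by `H'`, the coefficients of `Mj` and `Mi` are the derivatives of `H' *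
  -- H = 1`, hence zero.
  have di := mul_matWeakPartial_add hH' hH hinv i
  have dj := mul_matWeakPartial_add hH' hH hinv j
  refine h2.congr ?_ ?_ ?_
  · filter_upwards [hinv] with x hx
    rw [← mul_assoc, hx, one_mul]
  · filter_upwards [hinv] with x hx
    rw [← mul_assoc, hx, one_mul]
  · filter_upwards [hinv, di, dj] with x hx hi hj
    calc _ = (H' x * H x) * R x
          + (H' x * matWeakPartial U i H x + matWeakPartial U i H' x * H x) * Mj x
          - (H' x * matWeakPartial U j H x + matWeakPartial U j H' x * H x) * Mi x := by
          noncomm_ring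
      _ = R x := by rw [hx, hi, hj]; simp

/-- Multiplication on the right by an invertible matrix field. -/
lemma hasCurl_mul_right_iff (hH : MatMemWB U H) (hH' : MatMemWB U H')
    (hinv : ∀ᵐ x ∂volume.restrict (U : Set Plane), H x * H' x = 1)
    (hMi : MatMemLpLoc U 2 Mi) (hMj : MatMemLpLoc U 2 Mj) (hR : MatMemLpLoc U 1 R) :
    HasCurl U i j (fun x => Mi x * H x) (fun x => Mj x * H x)
      (fun x => R x * H x + Mj x * matWeakPartial U i H x - Mi x * matWeakPartial U j H x) ↔
    HasCurl U i j Mi Mj R := by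
  -- Transposition turns right multiplication into left multiplication.
  have := hasCurl_mul_left_iff (i := i) (j := j) hH.transpose hH'.transpose
    (by filter_upwards [hinv] with x hx; rw [← transpose_mul, hx, transpose_one])
    hMi.transpose hMj.transpose hR.transpose
  rw [hasCurl_transpose_iff] at this
  rw [← this, ← hasCurl_transpose_iff]
  simp only [transpose_mul, transpose_add, transpose_sub]
  rfl

end MatrixFields

/-! ### An explicit square root of the extended metric. -/

section SquareRoot

open Matrix

/-- The three-dimensional extension of a two-dimensional matrix. -/
def extend (m : Matrix (Fin 2) (Fin 2) ℝ) : Matrix (Fin 3) (Fin 3) ℝ :=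
  !![m 0 0, m 0 1, 0; m 1 0, m 1 1, 0; 0, 0, 1]

/-- The normalising factor in the formula for the square root of a `2 × 2` matrix. -/
noncomputable def sqrtFactor (m : Matrix (Fin 2) (Fin 2) ℝ) : ℝ :=
  (√(m 0 0 + m 1 1 + 2 * (m.det * (√m.det)⁻¹)))⁻¹

/-- The explicit square root of the extension of a positive definite `2 × 2` matrix. -/
noncomputable def extendSqrt (m : Matrix (Fin 2) (Fin 2) ℝ) : Matrix (Fin 3) (Fin 3) ℝ :=
  !![sqrtFactor m * (m 0 0 + m.det * (√m.det)⁻¹), sqrtFactor m * m 0 1, 0;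
     sqrtFactor m * m 1 0, sqrtFactor m * (m 1 1 + m.det * (√m.det)⁻¹), 0; 0, 0, 1]

/-- The inverse of the square root of the extension of a positive definite `2 × 2` matrix. -/
noncomputable def extendSqrtInv (m : Matrix (Fin 2) (Fin 2) ℝ) : Matrix (Fin 3) (Fin 3) ℝ :=
  !![(√m.det)⁻¹ * (sqrtFactor m * (m 1 1 + m.det * (√m.det)⁻¹)),
      -((√m.det)⁻¹ * (sqrtFactor m * m 0 1)), 0;
     -((√m.det)⁻¹ * (sqrtFactor m * m 1 0)),
      (√m.det)⁻¹ * (sqrtFactor m * (m 0 0 + m.det * (√m.det)⁻¹)), 0; 0, 0, 1]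

variable {m : Matrix (Fin 2) (Fin 2) ℝ}

/-- The formulas above write `√det` as `det * (√det)⁻¹`, so that `t ↦ (√t)⁻¹` is the only function
for which the chain rule is needed. -/
lemma det_mul_inv_sqrt_det (hm : m.PosDef) : m.det * (√m.det)⁻¹ = √m.det := by
  have hd := hm.det_pos
  rw [← div_eq_mul_inv, div_eq_iff (Real.sqrt_pos.2 hd).ne', Real.mul_self_sqrt hd.le]

lemma apply_one_zero_of_posDef (hm : m.PosDef) : m 1 0 = m 0 1 := by
  simpa using hm.isHermitian.apply 0 1

lemma sqrtFactor_sq (hm : m.PosDef) :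
    sqrtFactor m ^ 2 * (m 0 0 + m 1 1 + 2 * √m.det) = 1 := by
  have h0 := hm.diag_pos (i := 0)
  have h1 := hm.diag_pos (i := 1)
  have hpos : 0 < m 0 0 + m 1 1 + 2 * √m.det := by positivity
  rw [sqrtFactor, det_mul_inv_sqrt_det hm, inv_pow, Real.sq_sqrt hpos.le,
    inv_mul_cancel₀ hpos.ne']

/-- With `δ = √det m`, Cayley–Hamilton gives `(m + δ)² = (tr m + 2δ) m`, and the factor `sqrtFactor
m` normalises the scalar. -/
lemma extendSqrt_mul_self (hm : m.PosDef) : extendSqrt m * extendSqrt m = extend m := by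
  have h1 := apply_one_zero_of_posDef hm
  have h2 := sqrtFactor_sq hm
  have h3 := Real.sq_sqrt hm.det_pos.le
  have h4 : m.det = m 0 0 * m 1 1 - m 0 1 * m 0 1 := by rw [det_fin_two, h1]
  rw [extendSqrt, det_mul_inv_sqrt_det hm, extend]
  generalize sqrtFactor m = τ at *
  generalize √m.det = δ at *
  rw [h4] at h3
  ext r s
  fin_cases r <;> fin_cases s <;>
    simp [Matrix.mul_apply, Fin.sum_univ_three, h1]
  · linear_combination (m 0 0) * h2 + τ ^ 2 * h3
  · linear_combination (m 0 1) * h2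
  · linear_combination (m 0 1) * h2
  · linear_combination (m 1 1) * h2 + τ ^ 2 * h3

/-- On the 2×2 block `det (m + δ) = δ (tr m + 2δ)`, so the normalised root has determinant `δ = √det
m` and its inverse is the adjugate divided by `δ`. -/
lemma extendSqrt_mul_extendSqrtInv (hm : m.PosDef) : extendSqrt m * extendSqrtInv m = 1 := by
  have h1 := apply_one_zero_of_posDef hm
  have h2 := sqrtFactor_sq hm
  have h3 := Real.sq_sqrt hm.det_pos.le
  have h4 : m.det = m 0 0 * m 1 1 - m 0 1 * m 0 1 := by rw [det_fin_two, h1]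
  have h5 : √m.det * (√m.det)⁻¹ = 1 := mul_inv_cancel₀ (Real.sqrt_pos.2 hm.det_pos).ne'
  rw [extendSqrt, extendSqrtInv, det_mul_inv_sqrt_det hm]
  generalize sqrtFactor m = τ at *
  generalize √m.det = δ at *
  generalize δ⁻¹ = σ at *
  rw [h4] at h3
  ext r s
  fin_cases r <;> fin_cases s <;>
    simp [Matrix.mul_apply, Fin.sum_univ_three, h1]
  · linear_combination δ * σ * h2 - τ ^ 2 * σ * h3 + h5
  · ring
  · ring
  · linear_combination δ * σ * h2 - τ ^ 2 * σ * h3 + h5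

lemma extendSqrt_transpose (hm : m.PosDef) : (extendSqrt m)ᵀ = extendSqrt m := by
  have h1 := apply_one_zero_of_posDef hm
  rw [extendSqrt, h1]
  ext r s
  fin_cases r <;> fin_cases s <;> simp

/-- With `w = (v 0, v 1)`, the quadratic form is `τ (w · m w + δ |w|²) + (v 2)²`, where `τ, δ ≥ 0`.
-/
lemma extendSqrt_posSemidef (hm : m.PosDef) : (extendSqrt m).PosSemidef := by
  refine PosSemidef.of_dotProduct_mulVec_nonneg ?_ fun v => ?_
  · rw [IsHermitian, conjTranspose_eq_transpose_of_trivial, extendSqrt_transpose hm]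
  · have hq := hm.posSemidef.dotProduct_mulVec_nonneg ![v 0, v 1]
    have hτ : 0 ≤ sqrtFactor m := inv_nonneg.2 (Real.sqrt_nonneg _)
    have hδ := Real.sqrt_nonneg m.det
    rw [extendSqrt, det_mul_inv_sqrt_det hm]
    simp [dotProduct, mulVec, Fin.sum_univ_three, Fin.sum_univ_two] at hq ⊢
    have := mul_nonneg hτ (add_nonneg hq
      (mul_nonneg hδ (add_nonneg (sq_nonneg (v 0)) (sq_nonneg (v 1)))))
    nlinarith [sq_nonneg (v 2)]

open scoped MatrixOrder in
lemma sqrt_extend (hm : m.PosDef) : CFC.sqrt (extend m) = extendSqrt m :=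
  CFC.sqrt_unique (extendSqrt_mul_self hm) (extendSqrt_posSemidef hm).nonneg

lemma le_det_of_forall_spectrum {C : ℝ} (hm : m.PosDef) (hC : 0 < C)
    (h : ∀ μ ∈ spectrum ℝ m, C ≤ μ) : C ^ 2 ≤ m.det := by
  have hd := hm.isHermitian.det_eq_prod_eigenvalues
  rw [Fin.prod_univ_two] at hd
  have h0 := h _ (hm.isHermitian.eigenvalues_mem_spectrum_real 0)
  have h1 := h _ (hm.isHermitian.eigenvalues_mem_spectrum_real 1)
  rw [hd, pow_two]
  exact mul_le_mul h0 h1 hC.le (hC.le.trans h0)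

end SquareRoot

/-! ### Regularity of the metric, its square root and their inverses. -/

/-- The assumptions on the coefficients `(a_{ij})`. -/
structure IsMetric (U : Opens Plane) (a : Plane → Matrix (Fin 2) (Fin 2) ℝ) : Prop where
  memW12Loc : ∀ i j, MemW12Loc U fun x => a x i j
  memLpLoc_top : ∀ i j, MemLpLoc U ∞ fun x => a x i j
  posDef : ∀ᵐ x ∂volume.restrict (U : Set Plane), (a x).PosDef
  le_spectrum : ∀ K : Set Plane, IsCompact K → K ⊆ U →
    ∃ C : ℝ, 0 < C ∧ ∀ᵐ x ∂volume.restrict K, ∀ μ ∈ spectrum ℝ (a x), C ≤ μ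

namespace IsMetric

open Matrix

variable {U : Opens Plane} {a : Plane → Matrix (Fin 2) (Fin 2) ℝ}

lemma memWB (ha : IsMetric U a) (i j : Fin 2) : MemWB U fun x => a x i j :=
  ⟨ha.memW12Loc i j, ha.memLpLoc_top i j⟩

lemma memWB_det (ha : IsMetric U a) : MemWB U fun x => (a x).det := by
  simp only [det_fin_two]
  exact ((ha.memWB 0 0).mul (ha.memWB 1 1)).sub ((ha.memWB 0 1).mul (ha.memWB 1 0))

lemma exists_le_det (ha : IsMetric U a) (K : Set Plane) (hK : IsCompact K) (hKU : K ⊆ U) :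
    ∃ c : ℝ, 0 < c ∧ ∀ᵐ x ∂volume.restrict K, c ≤ (a x).det := by
  obtain ⟨C, hC, h⟩ := ha.le_spectrum K hK hKU
  refine ⟨C ^ 2, by positivity, ?_⟩
  filter_upwards [h, ae_restrict_of_subset ha.posDef hKU] with x h1 h2
  exact le_det_of_forall_spectrum h2 hC h1

lemma memWB_inv_sqrt_det (ha : IsMetric U a) : MemWB U fun x => (√(a x).det)⁻¹ :=
  ha.memWB_det.inv_sqrt ha.exists_le_det

lemma memWB_sqrtFactor (ha : IsMetric U a) : MemWB U fun x => sqrtFactor (a x) := by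
  refine (((ha.memWB 0 0).add (ha.memWB 1 1)).add
    ((memWB_const 2).mul (ha.memWB_det.mul ha.memWB_inv_sqrt_det))).inv_sqrt fun K hK hKU => ?_
  obtain ⟨c, hc, h⟩ := ha.exists_le_det K hK hKU
  -- The trace is positive, so `2 √det` alone bounds the argument of the inverse square root from
  -- below.
  refine ⟨2 * √c, by positivity, ?_⟩
  filter_upwards [h, ae_restrict_of_subset ha.posDef hKU] with x h1 h2
  rw [det_mul_inv_sqrt_det h2]
  have := Real.sqrt_le_sqrt h1
  have h3 := h2.diag_pos (i := 0)
  have h4 := h2.diag_pos (i := 1)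
  linarith

lemma G_ae_eq (ha : IsMetric U a) :
    G a =ᵐ[volume.restrict (U : Set Plane)] fun x => extendSqrt (a x) := by
  filter_upwards [ha.posDef] with x hx
  exact sqrt_extend hx

lemma inv_G_ae_eq (ha : IsMetric U a) :
    (fun x => (G a x)⁻¹) =ᵐ[volume.restrict (U : Set Plane)] fun x => extendSqrtInv (a x) := by
  filter_upwards [ha.posDef, ha.G_ae_eq] with x hx h
  rw [h, inv_eq_right_inv (extendSqrt_mul_extendSqrtInv hx)]

lemma matMemWB_extendSqrt (ha : IsMetric U a) : MatMemWB U fun x => extendSqrt (a x) := by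
  have hδ := ha.memWB_det.mul ha.memWB_inv_sqrt_det
  have hτ := ha.memWB_sqrtFactor
  intro r s
  fin_cases r <;> fin_cases s
  · exact hτ.mul ((ha.memWB 0 0).add hδ)
  · exact hτ.mul (ha.memWB 0 1)
  · exact memWB_const 0
  · exact hτ.mul (ha.memWB 1 0)
  · exact hτ.mul ((ha.memWB 1 1).add hδ)
  · exact memWB_const 0
  · exact memWB_const 0
  · exact memWB_const 0
  · exact memWB_const 1

lemma matMemWB_extendSqrtInv (ha : IsMetric U a) : MatMemWB U fun x => extendSqrtInv (a x) := by
  have hδ := ha.memWB_det.mul ha.memWB_inv_sqrt_det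
  have hτ := ha.memWB_sqrtFactor
  have hσ := ha.memWB_inv_sqrt_det
  intro r s
  fin_cases r <;> fin_cases s
  · exact hσ.mul (hτ.mul ((ha.memWB 1 1).add hδ))
  · exact (hσ.mul (hτ.mul (ha.memWB 0 1))).neg
  · exact memWB_const 0
  · exact (hσ.mul (hτ.mul (ha.memWB 1 0))).neg
  · exact hσ.mul (hτ.mul ((ha.memWB 0 0).add hδ))
  · exact memWB_const 0
  · exact memWB_const 0
  · exact memWB_const 0
  · exact memWB_const 1

lemma matMemWB_G (ha : IsMetric U a) : MatMemWB U (G a) := fun r s =>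
  (ha.matMemWB_extendSqrt r s).congr (ae_apply_eq ha.G_ae_eq.symm r s)

lemma matMemWB_inv_G (ha : IsMetric U a) : MatMemWB U fun x => (G a x)⁻¹ := fun r s =>
  (ha.matMemWB_extendSqrtInv r s).congr (ae_apply_eq ha.inv_G_ae_eq.symm r s)

lemma G_mul_inv_G (ha : IsMetric U a) :
    ∀ᵐ x ∂volume.restrict (U : Set Plane), G a x * (G a x)⁻¹ = 1 := by
  filter_upwards [ha.posDef, ha.G_ae_eq, ha.inv_G_ae_eq] with x hx h h'
  rw [h', h, extendSqrt_mul_extendSqrtInv hx]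

lemma inv_G_mul_G (ha : IsMetric U a) :
    ∀ᵐ x ∂volume.restrict (U : Set Plane), (G a x)⁻¹ * G a x = 1 := by
  filter_upwards [ha.G_mul_inv_G] with x hx
  exact mul_eq_one_comm.1 hx

lemma G_mul_G (ha : IsMetric U a) :
    (fun x => G a x * G a x) =ᵐ[volume.restrict (U : Set Plane)] fun x => extend (a x) := by
  filter_upwards [ha.posDef, ha.G_ae_eq] with x hx h
  rw [h, extendSqrt_mul_self hx]

lemma G_transpose (ha : IsMetric U a) :
    (fun x => (G a x)ᵀ) =ᵐ[volume.restrict (U : Set Plane)] G a := by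
  filter_upwards [ha.posDef, ha.G_ae_eq] with x hx h
  rw [h, extendSqrt_transpose hx]

lemma matMemWB_extend (ha : IsMetric U a) : MatMemWB U fun x => extend (a x) := fun r s =>
  (ha.matMemWB_G.mul ha.matMemWB_G r s).congr (ae_apply_eq ha.G_mul_G r s)

/-- The factor `det⁻¹` in Cramer's formula is the square of `(√det)⁻¹`, whose regularity is already
available. -/
lemma memWB_inv (ha : IsMetric U a) (k l : Fin 2) : MemWB U fun x => (a x)⁻¹ k l := by
  have hs : ∀ᵐ x ∂volume.restrict (U : Set Plane),
      (a x)⁻¹ = ((√(a x).det)⁻¹ * (√(a x).det)⁻¹) • !![a x 1 1, -a x 0 1; -a x 1 0, a x 0 0] := by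
    filter_upwards [ha.posDef] with x hx
    rw [inv_def, adjugate_fin_two, Ring.inverse_eq_inv', ← mul_inv,
      Real.mul_self_sqrt hx.det_pos.le]
  have hσ := ha.memWB_inv_sqrt_det.mul ha.memWB_inv_sqrt_det
  have h : MatMemWB U fun x =>
      ((√(a x).det)⁻¹ * (√(a x).det)⁻¹) • !![a x 1 1, -a x 0 1; -a x 1 0, a x 0 0] := by
    intro r s
    fin_cases r <;> fin_cases s
    · exact hσ.mul (ha.memWB 1 1)
    · exact hσ.mul (ha.memWB 0 1).neg
    · exact hσ.mul (ha.memWB 1 0).neg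
    · exact hσ.mul (ha.memWB 0 0)
  exact (h k l).congr (ae_apply_eq (Filter.EventuallyEq.symm hs) k l)

end IsMetric

/-! ### Metric compatibility and change of gauge. -/

open Matrix

variable {U : Opens Plane} {a b : Plane → Matrix (Fin 2) (Fin 2) ℝ}

/-- The matrix with columns `(Γ_{i1·}, b_{i1})`, `(Γ_{i2·}, b_{i2})`, `(-b_{i·}, 0)`. -/
noncomputable def lowGam (U : Opens Plane) (a b : Plane → Matrix (Fin 2) (Fin 2) ℝ) (i : Fin 2)
    (x : Plane) : Matrix (Fin 3) (Fin 3) ℝ :=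
  !![christoffelLow U a i 0 0 x, christoffelLow U a i 1 0 x, -b x i 0;
     christoffelLow U a i 0 1 x, christoffelLow U a i 1 1 x, -b x i 1;
     b x i 0, b x i 1, 0]

namespace IsMetric

lemma apply_comm (ha : IsMetric U a) (i j : Fin 2) :
    (fun x => a x i j) =ᵐ[volume.restrict (U : Set Plane)] fun x => a x j i := by
  filter_upwards [ha.posDef] with x hx
  simpa using hx.isHermitian.apply j i

lemma weakPartial_comm (ha : IsMetric U a) : ∀ᵐ x ∂volume.restrict (U : Set Plane),
    ∀ k i j, weakPartial U k (fun y => a y i j) x = weakPartial U k (fun y => a y j i) x := by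
  simp only [Filter.eventually_all]
  exact fun k i j => (ha.memW12Loc i j).weakPartial_congr k (ha.apply_comm i j)

lemma christoffel_comm (ha : IsMetric U a) : ∀ᵐ x ∂volume.restrict (U : Set Plane),
    ∀ k i j, christoffel U a k i j x = christoffel U a k j i x := by
  filter_upwards [ha.weakPartial_comm] with x hx k i j
  unfold christoffel
  refine congrArg _ (Finset.sum_congr rfl fun l _ => ?_)
  rw [hx l i j]
  ring

lemma christoffelLow_eq (ha : IsMetric U a) : ∀ᵐ x ∂volume.restrict (U : Set Plane),
    ∀ i j k, christoffelLow U a i j k x = 1 / 2 * (weakPartial U j (fun y => a y i k) x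
      + weakPartial U i (fun y => a y j k) x - weakPartial U k (fun y => a y i j) x) := by
  filter_upwards [ha.posDef] with x hx i j k
  have h1 : a x * (a x)⁻¹ = 1 := mul_nonsing_inv _ (isUnit_iff_ne_zero.2 hx.det_pos.ne')
  let v : Fin 2 → ℝ := fun l => weakPartial U j (fun y => a y i l) x
    + weakPartial U i (fun y => a y j l) x - weakPartial U l (fun y => a y i j) x
  have h : christoffelLow U a i j k x = (a x *ᵥ ((1 / 2 : ℝ) • ((a x)⁻¹ *ᵥ v))) k := rfl
  rw [h, mulVec_smul, mulVec_mulVec, h1, one_mulVec]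
  rfl

lemma sum_mul_bMixed (ha : IsMetric U a) : ∀ᵐ x ∂volume.restrict (U : Set Plane),
    ∀ i k, ∑ l, a x k l * bMixed a b i l x = b x i k := by
  filter_upwards [ha.posDef] with x hx i k
  have h1 : a x * (a x)⁻¹ = 1 := mul_nonsing_inv _ (isUnit_iff_ne_zero.2 hx.det_pos.ne')
  have h : ∑ l, a x k l * bMixed a b i l x = ((a x * (a x)⁻¹) *ᵥ (b x i)) k := by
    rw [← mulVec_mulVec]
    rfl
  rw [h, h1, one_mulVec]

lemma extend_mul_Gam (ha : IsMetric U a) (i : Fin 2) :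
    (fun x => extend (a x) * Gam U a b i x) =ᵐ[volume.restrict (U : Set Plane)]
      lowGam U a b i := by
  filter_upwards [ha.sum_mul_bMixed (b := b)] with x hx
  have h := fun k => hx i k
  simp only [Fin.sum_univ_two] at h
  ext r s
  fin_cases r <;> fin_cases s <;>
    simp [extend, Gam, lowGam, mul_apply, Fin.sum_univ_three, christoffelLow, ← h] <;> ring

/-- Metric compatibility, `∂ᵢ a_{kl} = Γ_{ikl} + Γ_{ilk}`. The entries from `b` are antisymmetric
and cancel, so the identity holds for every `b`. -/
lemma matWeakPartial_extend (ha : IsMetric U a) (i : Fin 2) :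
    matWeakPartial U i (fun x => extend (a x)) =ᵐ[volume.restrict (U : Set Plane)]
      fun x => lowGam U a b i x + (lowGam U a b i x)ᵀ := by
  have h0 := (isWeakPartial_const (U := U) (i := i) 0).weakPartial_ae_eq
  have h1 := (isWeakPartial_const (U := U) (i := i) 1).weakPartial_ae_eq
  filter_upwards [ha.weakPartial_comm, ha.christoffelLow_eq, h0, h1] with x hx hL h0 h1
  ext r s
  fin_cases r <;> fin_cases s <;>
    simp [matWeakPartial, extend, lowGam, hL, h0, h1, hx _ 1 0] <;> ring

lemma dG_add (ha : IsMetric U a) (i : Fin 2) : ∀ᵐ x ∂volume.restrict (U : Set Plane),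
    G a x * dG U a i x + dG U a i x * G a x = lowGam U a b i x + (lowGam U a b i x)ᵀ := by
  filter_upwards [matWeakPartial_mul ha.matMemWB_G ha.matMemWB_G i,
    matWeakPartial_congr (ha.matMemWB_G.mul ha.matMemWB_G) i ha.G_mul_G,
    ha.matWeakPartial_extend (b := b) i] with x h1 h2 h3
  rw [← h3, ← h2, h1]
  rfl

lemma dG_transpose (ha : IsMetric U a) (i : Fin 2) :
    (fun x => (dG U a i x)ᵀ) =ᵐ[volume.restrict (U : Set Plane)] dG U a i :=
  matWeakPartial_congr ha.matMemWB_G.transpose i ha.G_transpose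

lemma Om_mul_G (ha : IsMetric U a) (i : Fin 2) :
    (fun x => Om U a b i x * G a x) =ᵐ[volume.restrict (U : Set Plane)]
      fun x => G a x * Gam U a b i x - dG U a i x := by
  filter_upwards [ha.inv_G_mul_G] with x hx
  rw [Om, mul_assoc, hx, mul_one]

lemma Om_transpose (ha : IsMetric U a) (i : Fin 2) : ∀ᵐ x ∂volume.restrict (U : Set Plane),
    (Om U a b i x)ᵀ = -Om U a b i x := by
  filter_upwards [ha.inv_G_mul_G, ha.G_mul_inv_G, ha.Om_mul_G (b := b) i, ha.G_mul_G,
    ha.extend_mul_Gam (b := b) i, ha.dG_add (b := b) i, ha.dG_transpose i, ha.G_transpose]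
    with x h1 h2 h3 h4 h5 h6 h7 h8
  have e : G a x * Om U a b i x * G a x = lowGam U a b i x - G a x * dG U a i x := by
    rw [mul_assoc, h3, mul_sub, ← mul_assoc, h4, h5]
  have e' := congrArg transpose e
  rw [transpose_sub, transpose_mul, transpose_mul, transpose_mul, h7, h8, ← mul_assoc] at e'
  -- Both `dG_add` and `e` plus its transpose express the derivative of `G * G`; their difference
  -- vanishes, and cancelling the invertible `G` on both sides gives antisymmetry.
  have hz : G a x * (Om U a b i x + (Om U a b i x)ᵀ) * G a x = 0 := by
    rw [mul_add, add_mul, e, e', ← add_sub_add_comm, h6, sub_self]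
  have := congrArg (fun Z => (G a x)⁻¹ * Z * (G a x)⁻¹) hz
  simp only [mul_zero, zero_mul] at this
  rw [mul_assoc (G a x), ← mul_assoc, h1, one_mul, mul_assoc, h2, mul_one] at this
  rw [eq_neg_iff_add_eq_zero, add_comm, this]

lemma memLpLoc_christoffel (ha : IsMetric U a) (k i j : Fin 2) :
    MemLpLoc U 2 (christoffel U a k i j) := by
  have h : ∀ l, MemLpLoc U 2 fun x => weakPartial U j (fun y => a y i l) x
      + weakPartial U i (fun y => a y j l) x - weakPartial U l (fun y => a y i j) x := fun l =>
    (((ha.memWB i l).memLpLoc_weakPartial j).add ((ha.memWB j l).memLpLoc_weakPartial i)).sub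
      ((ha.memWB i j).memLpLoc_weakPartial l)
  exact (memLpLoc_const (p := ∞) (1 / 2)).mul
    (MemLpLoc.sum _ fun l _ => (ha.memWB_inv k l).2.mul (h l) : MemLpLoc U 2 _)

lemma memLpLoc_christoffelLow (ha : IsMetric U a) (i j k : Fin 2) :
    MemLpLoc U 2 (christoffelLow U a i j k) :=
  MemLpLoc.sum _ fun l _ => (ha.memWB k l).2.mul (ha.memLpLoc_christoffel l i j)

lemma memLpLoc_bMixed (ha : IsMetric U a) (hb : ∀ i j, MemLpLoc U 2 fun x => b x i j)
    (i j : Fin 2) : MemLpLoc U 2 (bMixed a b i j) :=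
  MemLpLoc.sum _ fun k _ => (ha.memWB_inv j k).2.mul (hb i k)

lemma matMemLpLoc_Gam (ha : IsMetric U a) (hb : ∀ i j, MemLpLoc U 2 fun x => b x i j)
    (i : Fin 2) : MatMemLpLoc U 2 (Gam U a b i) := by
  intro r s
  fin_cases r <;> fin_cases s
  · exact ha.memLpLoc_christoffel 0 i 0
  · exact ha.memLpLoc_christoffel 0 i 1
  · exact (ha.memLpLoc_bMixed hb i 0).neg
  · exact ha.memLpLoc_christoffel 1 i 0
  · exact ha.memLpLoc_christoffel 1 i 1
  · exact (ha.memLpLoc_bMixed hb i 1).neg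
  · exact hb i 0
  · exact hb i 1
  · exact memLpLoc_const 0

lemma matMemLpLoc_Om (ha : IsMetric U a) (hb : ∀ i j, MemLpLoc U 2 fun x => b x i j)
    (i : Fin 2) : MatMemLpLoc U 2 (Om U a b i) :=
  ((ha.matMemWB_G.memLpLoc_top.mul (ha.matMemLpLoc_Gam hb i)).sub
    (ha.matMemWB_G.matWeakPartial i) : MatMemLpLoc U 2 _).mul ha.matMemWB_inv_G.memLpLoc_top

lemma matMemLpLoc_commutator {M N : Plane → Matrix (Fin 3) (Fin 3) ℝ} (hM : MatMemLpLoc U 2 M)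
    (hN : MatMemLpLoc U 2 N) : MatMemLpLoc U 1 fun x => N x * M x - M x * N x :=
  (hN.mul hM).sub (hM.mul hN)

/-- A gauge transformation: the equation for `Ω` is multiplied by `G` on the right, the one for `Γ`
by `G` on the left, and the two products differ by the curl-free field `∂G`. -/
lemma hasCurl_Om_iff (ha : IsMetric U a) (hb : ∀ i j, MemLpLoc U 2 fun x => b x i j)
    (i j : Fin 2) :
    HasCurl U i j (Om U a b i) (Om U a b j)
      (fun x => Om U a b j x * Om U a b i x - Om U a b i x * Om U a b j x) ↔
    HasCurl U i j (Gam U a b i) (Gam U a b j)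
      (fun x => Gam U a b j x * Gam U a b i x - Gam U a b i x * Gam U a b j x) := by
  have hΓ := ha.matMemLpLoc_Gam hb
  have hΩ := ha.matMemLpLoc_Om hb
  have hG := ha.matMemWB_G
  rw [← hasCurl_mul_right_iff hG ha.matMemWB_inv_G ha.G_mul_inv_G (hΩ i) (hΩ j)
      (matMemLpLoc_commutator (hΩ i) (hΩ j)),
    ← hasCurl_mul_left_iff hG ha.matMemWB_inv_G ha.inv_G_mul_G (hΓ i) (hΓ j)
      (matMemLpLoc_commutator (hΓ i) (hΓ j)),
    ← hasCurl_sub_matWeakPartial_iff hG (hG.memLpLoc_top.mul (hΓ i)) (hG.memLpLoc_top.mul (hΓ j))]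
  refine hasCurl_congr (ha.Om_mul_G i) (ha.Om_mul_G j) ?_
  filter_upwards [ha.Om_mul_G (b := b) i, ha.Om_mul_G (b := b) j] with x hi hj
  change _ + _ * dG U a i x - _ * dG U a j x = _ + dG U a i x * _ - dG U a j x * _
  -- Once `∂G` is eliminated, equality of the two right-hand sides is an identity of noncommutative
  -- polynomials in `G`, `Γ` and `Ω`.
  have hi' : dG U a i x = G a x * Gam U a b i x - Om U a b i x * G a x := by rw [hi]; abel
  have hj' : dG U a j x = G a x * Gam U a b j x - Om U a b j x * G a x := by rw [hj]; abel
  rw [hi', hj']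
  noncomm_ring

/-- Substituting `∂ᵢA = AΓᵢ + ΓᵢᵀA` into the product rule, the terms `AΓᵢ` cancel the commutator and
only the transposed terms remain. -/
lemma hasCurl_Gam_iff (ha : IsMetric U a) (hb : ∀ i j, MemLpLoc U 2 fun x => b x i j)
    (i j : Fin 2) :
    HasCurl U i j (Gam U a b i) (Gam U a b j)
      (fun x => Gam U a b j x * Gam U a b i x - Gam U a b i x * Gam U a b j x) ↔
    HasCurl U i j (lowGam U a b i) (lowGam U a b j)
      (fun x => (Gam U a b i x)ᵀ * lowGam U a b j x - (Gam U a b j x)ᵀ * lowGam U a b i x) := by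
  have hΓ := ha.matMemLpLoc_Gam hb
  have hA := ha.matMemWB_extend
  have hinv : ∀ᵐ x ∂volume.restrict (U : Set Plane),
      ((G a x)⁻¹ * (G a x)⁻¹) * extend (a x) = 1 := by
    filter_upwards [ha.inv_G_mul_G, ha.G_mul_G] with x h1 h2
    rw [← h2, mul_assoc, ← mul_assoc _ (G a x), h1, one_mul, h1]
  rw [← hasCurl_mul_left_iff hA (ha.matMemWB_inv_G.mul ha.matMemWB_inv_G) hinv (hΓ i) (hΓ j)
      (matMemLpLoc_commutator (hΓ i) (hΓ j))]
  refine hasCurl_congr (ha.extend_mul_Gam i) (ha.extend_mul_Gam j) ?_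
  filter_upwards [ha.extend_mul_Gam (b := b) i, ha.extend_mul_Gam (b := b) j,
    ha.matWeakPartial_extend (b := b) i, ha.matWeakPartial_extend (b := b) j, ha.posDef]
    with x hi hj di dj hx
  have hs : (extend (a x))ᵀ = extend (a x) := by
    rw [← extendSqrt_mul_self hx, transpose_mul, extendSqrt_transpose hx]
  rw [di, dj, ← hi, ← hj, transpose_mul, transpose_mul, hs]
  noncomm_ring

end IsMetric

/-! ### Reading the Gauss and Codazzi–Mainardi equations off the matrix entries. -/

lemma compatibility_iff : Compatibility U a b ↔ ∀ i j, HasCurl U i j (Om U a b i) (Om U a b j)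
    (fun x => Om U a b j x * Om U a b i x - Om U a b i x * Om U a b j x) := Iff.rfl

lemma gammaCompatibility_iff (ha : IsMetric U a) (hb : ∀ i j, MemLpLoc U 2 fun x => b x i j) :
    GammaCompatibility U a b ↔ ∀ i j, HasCurl U i j (Gam U a b i) (Gam U a b j)
      (fun x => Gam U a b j x * Gam U a b i x - Gam U a b i x * Gam U a b j x) := by
  refine forall_congr' fun i => forall_congr' fun j => forall_congr' fun r => forall_congr' fun s =>
    ?_
  have hΓ := ha.matMemLpLoc_Gam hb
  have l : ∀ i j, LocallyIntegrableOn (fun x => (Gam U a b i x * Gam U a b j x) r s) U :=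
    fun i j => memLpLoc_one_iff.1 (((hΓ i).mul (hΓ j) : MatMemLpLoc U 1 _) r s)
  have he : toDist U (fun x => (Gam U a b j x * Gam U a b i x - Gam U a b i x * Gam U a b j x) r s)
      = toDist U (fun x => (Gam U a b j x * Gam U a b i x) r s)
        - toDist U (fun x => (Gam U a b i x * Gam U a b j x) r s) := toDist_sub (l j i) (l i j)
  rw [he, sub_eq_sub_iff_add_eq_add, add_comm _ (∂_{e j} _)]

lemma lowGam_castSucc_castSucc (i k l : Fin 2) (x : Plane) :
    lowGam U a b i x k.castSucc l.castSucc = christoffelLow U a i l k x := by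
  fin_cases k <;> fin_cases l <;> rfl

lemma lowGam_last_castSucc (i l : Fin 2) (x : Plane) :
    lowGam U a b i x (Fin.last 2) l.castSucc = b x i l := by
  fin_cases l <;> rfl

lemma lowGam_castSucc_last (i k : Fin 2) (x : Plane) :
    lowGam U a b i x k.castSucc (Fin.last 2) = -b x i k := by
  fin_cases k <;> rfl

lemma lowGam_last_last (i : Fin 2) (x : Plane) :
    lowGam U a b i x (Fin.last 2) (Fin.last 2) = 0 := rfl

lemma Gam_castSucc_castSucc (i k l : Fin 2) (x : Plane) :
    Gam U a b i x k.castSucc l.castSucc = christoffel U a k i l x := by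
  fin_cases k <;> fin_cases l <;> rfl

lemma Gam_last_castSucc (i l : Fin 2) (x : Plane) :
    Gam U a b i x (Fin.last 2) l.castSucc = b x i l := by
  fin_cases l <;> rfl

lemma Gam_castSucc_last (i k : Fin 2) (x : Plane) :
    Gam U a b i x k.castSucc (Fin.last 2) = -bMixed a b i k x := by
  fin_cases k <;> rfl

lemma Gam_last_last (i : Fin 2) (x : Plane) :
    Gam U a b i x (Fin.last 2) (Fin.last 2) = 0 := rfl

/-- The right-hand side of the equation `∂ᵢ (AΓⱼ) - ∂ⱼ (AΓᵢ) = ΓᵢᵀAΓⱼ - ΓⱼᵀAΓᵢ`. -/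
noncomputable def lowRhs (U : Opens Plane) (a b : Plane → Matrix (Fin 2) (Fin 2) ℝ) (i j : Fin 2)
    (x : Plane) : Matrix (Fin 3) (Fin 3) ℝ :=
  (Gam U a b i x)ᵀ * lowGam U a b j x - (Gam U a b j x)ᵀ * lowGam U a b i x

/-- The quadratic Christoffel terms in the Gauss equations. -/
noncomputable def gaussTerm (U : Opens Plane) (a : Plane → Matrix (Fin 2) (Fin 2) ℝ)
    (i j k l : Fin 2) (x : Plane) : ℝ :=
  ∑ m, (christoffel U a m i j x * christoffelLow U a k l m x
    - christoffel U a m i k x * christoffelLow U a j l m x)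

/-- The zeroth order terms in the Codazzi–Mainardi equations. -/
noncomputable def codazziTerm (U : Opens Plane) (a b : Plane → Matrix (Fin 2) (Fin 2) ℝ)
    (i j k : Fin 2) (x : Plane) : ℝ :=
  ∑ m, (christoffel U a m i k x * b x j m - christoffel U a m i j x * b x k m)

namespace IsMetric

/-- The summed index is raised on one factor and lowered on the other, using the symmetry of `a`;
then the lower indices of the Christoffel symbol are swapped. -/
lemma sum_bMixed_mul_christoffelLow (ha : IsMetric U a) :
    ∀ᵐ x ∂volume.restrict (U : Set Plane), ∀ i j l,
      ∑ m, bMixed a b i m x * christoffelLow U a j l m x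
        = ∑ m, christoffel U a m l j x * b x i m := by
  filter_upwards [ha.apply_comm 0 1, ha.sum_mul_bMixed (b := b), ha.christoffel_comm]
    with x h1 h2 h3 i j l
  simp only [Fin.sum_univ_two, christoffelLow, ← h2, h3 _ l j]
  rw [h1]
  ring

/-- The `b` products come from the bottom row of the connection matrices. In the other products the
symmetry of `a` moves the lowered index to the opposite factor, as the Gauss equations require. -/
lemma lowRhs_castSucc_castSucc (ha : IsMetric U a)
    (hbs : ∀ᵐ x ∂volume.restrict (U : Set Plane), (b x).IsSymm) (i j k l : Fin 2) :
    (fun x => lowRhs U a b i j x k.castSucc l.castSucc) =ᵐ[volume.restrict (U : Set Plane)]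
      fun x => (b x l j * b x i k - b x l i * b x j k) - gaussTerm U a l i j k x := by
  filter_upwards [ha.apply_comm 0 1, ha.christoffel_comm, hbs] with x h1 h2 h3
  simp only [lowRhs, gaussTerm, Matrix.sub_apply, mul_apply, transpose_apply,
    Fin.sum_univ_castSucc (n := 2), lowGam_castSucc_castSucc, Gam_castSucc_castSucc,
    Gam_last_castSucc, lowGam_last_castSucc]
  simp only [Fin.sum_univ_two, christoffelLow, h2 _ l i, h2 _ l j, h3.apply l j, h3.apply l i]
  rw [h1]
  ring

lemma lowRhs_last_castSucc (ha : IsMetric U a) (i j l : Fin 2) :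
    (fun x => lowRhs U a b i j x (Fin.last 2) l.castSucc) =ᵐ[volume.restrict (U : Set Plane)]
      fun x => -codazziTerm U a b l i j x := by
  filter_upwards [ha.sum_bMixed_mul_christoffelLow (b := b)] with x h
  simp only [lowRhs, codazziTerm, Matrix.sub_apply, mul_apply, transpose_apply,
    Fin.sum_univ_castSucc (n := 2), lowGam_castSucc_castSucc, Gam_castSucc_last,
    Gam_last_last, lowGam_last_castSucc, neg_mul, Finset.sum_neg_distrib, h,
    Finset.sum_sub_distrib]
  ring

lemma lowRhs_castSucc_last (ha : IsMetric U a) (i j k : Fin 2) :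
    (fun x => lowRhs U a b i j x k.castSucc (Fin.last 2)) =ᵐ[volume.restrict (U : Set Plane)]
      codazziTerm U a b k i j := by
  filter_upwards [ha.christoffel_comm] with x h
  simp only [lowRhs, codazziTerm, Matrix.sub_apply, mul_apply, transpose_apply,
    Fin.sum_univ_castSucc (n := 2), lowGam_castSucc_last, Gam_castSucc_castSucc, lowGam_last_last,
    h _ k i, h _ k j, Fin.sum_univ_two]
  ring

/-- The two terms are `a^{mn} b_{in} b_{jm}` and the same with `i`, `j` exchanged; they agree
because the metric is symmetric. -/
lemma lowRhs_last_last (ha : IsMetric U a) (i j : Fin 2) :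
    (fun x => lowRhs U a b i j x (Fin.last 2) (Fin.last 2)) =ᵐ[volume.restrict (U : Set Plane)]
      fun _ => 0 := by
  filter_upwards [ha.apply_comm 0 1, ha.sum_mul_bMixed (b := b)] with x h1 h2
  simp only [lowRhs, Matrix.sub_apply, mul_apply, transpose_apply,
    Fin.sum_univ_castSucc (n := 2), lowGam_castSucc_last, Gam_castSucc_last, lowGam_last_last,
    ← h2, Fin.sum_univ_two]
  rw [h1]
  ring

lemma locallyIntegrableOn_gaussTerm (ha : IsMetric U a) (i j k l : Fin 2) :
    LocallyIntegrableOn (gaussTerm U a i j k l) U :=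
  memLpLoc_one_iff.1 <| MemLpLoc.sum _ fun m _ =>
    ((ha.memLpLoc_christoffel m i j).mul (ha.memLpLoc_christoffelLow k l m)).sub
      ((ha.memLpLoc_christoffel m i k).mul (ha.memLpLoc_christoffelLow j l m))

lemma locallyIntegrableOn_codazziTerm (ha : IsMetric U a)
    (hb : ∀ i j, MemLpLoc U 2 fun x => b x i j) (i j k : Fin 2) :
    LocallyIntegrableOn (codazziTerm U a b i j k) U :=
  memLpLoc_one_iff.1 <| MemLpLoc.sum _ fun m _ =>
    ((ha.memLpLoc_christoffel m i k).mul (hb j m)).sub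
      ((ha.memLpLoc_christoffel m i j).mul (hb k m))

lemma toDist_christoffelLow_comm (ha : IsMetric U a) (i j k : Fin 2) :
    toDist U (christoffelLow U a i j k) = toDist U (christoffelLow U a j i k) := by
  refine toDist_congr ?_
  filter_upwards [ha.christoffel_comm] with x h
  simp only [christoffelLow, h _ i j]

lemma gauss_iff (ha : IsMetric U a) (hb : ∀ i j, MemLpLoc U 2 fun x => b x i j)
    (hbs : ∀ᵐ x ∂volume.restrict (U : Set Plane), (b x).IsSymm) (i j k l : Fin 2) :
    (∂_{e i} (toDist U fun x => lowGam U a b j x k.castSucc l.castSucc)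
        - ∂_{e j} (toDist U fun x => lowGam U a b i x k.castSucc l.castSucc)
      = toDist U fun x => lowRhs U a b i j x k.castSucc l.castSucc) ↔
    ∂_{e i} (toDist U (christoffelLow U a l j k)) - ∂_{e j} (toDist U (christoffelLow U a l i k))
        + toDist U (gaussTerm U a l i j k)
      = toDist U (fun x => b x l j * b x i k - b x l i * b x j k) := by
  have hbb : LocallyIntegrableOn (fun x => b x l j * b x i k - b x l i * b x j k) U :=
    memLpLoc_one_iff.1 (((hb l j).mul (hb i k)).sub ((hb l i).mul (hb j k)))
  rw [toDist_congr (ha.lowRhs_castSucc_castSucc hbs i j k l),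
    toDist_sub hbb (ha.locallyIntegrableOn_gaussTerm l i j k), eq_sub_iff_add_eq]
  simp only [lowGam_castSucc_castSucc]
  rw [ha.toDist_christoffelLow_comm l j, ha.toDist_christoffelLow_comm l i]

lemma codazzi_iff (ha : IsMetric U a) (hb : ∀ i j, MemLpLoc U 2 fun x => b x i j)
    (hbs : ∀ᵐ x ∂volume.restrict (U : Set Plane), (b x).IsSymm) (i j l : Fin 2) :
    (∂_{e i} (toDist U fun x => lowGam U a b j x (Fin.last 2) l.castSucc)
        - ∂_{e j} (toDist U fun x => lowGam U a b i x (Fin.last 2) l.castSucc)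
      = toDist U fun x => lowRhs U a b i j x (Fin.last 2) l.castSucc) ↔
    ∂_{e i} (toDist U fun x => b x l j) - ∂_{e j} (toDist U fun x => b x l i)
        + toDist U (codazziTerm U a b l i j) = 0 := by
  have hs : ∀ i j, toDist U (fun x => b x i j) = toDist U fun x => b x j i := fun i j =>
    toDist_congr (by filter_upwards [hbs] with x hx using hx.apply j i)
  rw [toDist_congr (ha.lowRhs_last_castSucc i j l),
    toDist_neg (ha.locallyIntegrableOn_codazziTerm hb l i j), eq_neg_iff_add_eq_zero]
  simp only [lowGam_last_castSucc]
  rw [hs l j, hs l i]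

/-- The last column carries `-b`, so it repeats the equation of the last row with the opposite sign.
-/
lemma codazzi_iff' (ha : IsMetric U a) (hb : ∀ i j, MemLpLoc U 2 fun x => b x i j)
    (hbs : ∀ᵐ x ∂volume.restrict (U : Set Plane), (b x).IsSymm) (i j k : Fin 2) :
    (∂_{e i} (toDist U fun x => lowGam U a b j x k.castSucc (Fin.last 2))
        - ∂_{e j} (toDist U fun x => lowGam U a b i x k.castSucc (Fin.last 2))
      = toDist U fun x => lowRhs U a b i j x k.castSucc (Fin.last 2)) ↔
    ∂_{e i} (toDist U fun x => b x k j) - ∂_{e j} (toDist U fun x => b x k i)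
        + toDist U (codazziTerm U a b k i j) = 0 := by
  have hs : ∀ i j, toDist U (fun x => b x i j) = toDist U fun x => b x j i := fun i j =>
    toDist_congr (by filter_upwards [hbs] with x hx using hx.apply j i)
  rw [toDist_congr (ha.lowRhs_castSucc_last i j k)]
  simp only [lowGam_castSucc_last]
  rw [toDist_neg ((hb j k).locallyIntegrableOn (by norm_num)),
    toDist_neg ((hb i k).locallyIntegrableOn (by norm_num)), LineDeriv.lineDerivOp_neg,
    LineDeriv.lineDerivOp_neg, hs k j, hs k i, neg_sub_neg, ← neg_sub, neg_eq_iff_add_eq_zero]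

/-- The Gauss and Codazzi–Mainardi equations, in matrix form. -/
lemma hasCurl_lowGam_iff (ha : IsMetric U a) (hb : ∀ i j, MemLpLoc U 2 fun x => b x i j)
    (hbs : ∀ᵐ x ∂volume.restrict (U : Set Plane), (b x).IsSymm) :
    (∀ i j, HasCurl U i j (lowGam U a b i) (lowGam U a b j) (lowRhs U a b i j)) ↔
      GaussEquations U a b ∧ CodazziMainardiEquations U a b := by
  constructor
  -- In the Gauss equation `j, k` are the differentiation indices, `l` is the row and `i` the
  -- column. For Codazzi–Mainardi the last row alone is enough.
  · exact fun h => ⟨fun i j k l => (ha.gauss_iff hb hbs j k l i).1 (h j k _ _),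
      fun i j k => (ha.codazzi_iff hb hbs j k i).1 (h j k _ _)⟩
  · rintro ⟨hG, hC⟩ i j r s
    refine Fin.lastCases ?_ (fun k => ?_) r <;> refine Fin.lastCases ?_ (fun l => ?_) s
    · simp only [lowGam_last_last]
      rw [toDist_congr (ha.lowRhs_last_last i j), toDist_zero, LineDeriv.lineDerivOp_zero,
        LineDeriv.lineDerivOp_zero, sub_self]
    · exact (ha.codazzi_iff hb hbs i j l).2 (hC l i j)
    · exact (ha.codazzi_iff' hb hbs i j k).2 (hC k i j)
    · exact (ha.gauss_iff hb hbs i j k l).2 (hG l i j k)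

end IsMetric

end SurfaceTheory

open SurfaceTheory
theorem mainTheorem6
    (U : Opens Plane) (hU : IsSimplyConnected (U : Set Plane))
    (a b : Plane → Matrix (Fin 2) (Fin 2) ℝ)
    (ha_sobolev : ∀ i j, MemW12Loc U fun x => a x i j)
    (ha_bounded : ∀ i j, MemLpLoc U ∞ fun x => a x i j)
    (ha_pos : ∀ᵐ x ∂volume.restrict (U : Set Plane), (a x).PosDef)
    (ha_eigenvalues : ∀ K : Set Plane, IsCompact K → K ⊆ U →
      ∃ C : ℝ, 0 < C ∧ ∀ᵐ x ∂volume.restrict K, ∀ μ ∈ spectrum ℝ (a x), C ≤ μ)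
    (hb : ∀ i j, MemLpLoc U 2 fun x => b x i j)
    (hb_symm : ∀ᵐ x ∂volume.restrict (U : Set Plane), (b x).IsSymm) :
    -- the objects are well defined: `G ∈ W^{1,2}_loc`, `Γ_i ∈ L^2_loc`, `Ω_i ∈ L^2_loc(U, so(3))`
    (∀ r s, MemW12Loc U fun x => G a x r s) ∧
    (∀ i r s, MemLpLoc U 2 fun x => Gam U a b i x r s) ∧
    (∀ i r s, MemLpLoc U 2 fun x => Om U a b i x r s) ∧
    (∀ i, ∀ᵐ x ∂volume.restrict (U : Set Plane), (Om U a b i x).transpose = -Om U a b i x) ∧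
    -- the equivalence
    (Compatibility U a b ↔ GaussEquations U a b ∧ CodazziMainardiEquations U a b) ∧
    -- the intermediate form of the compatibility condition
    (Compatibility U a b ↔ GammaCompatibility U a b) := by
  have ha : IsMetric U a := ⟨ha_sobolev, ha_bounded, ha_pos, ha_eigenvalues⟩
  refine ⟨fun r s => (ha.matMemWB_G r s).1, ha.matMemLpLoc_Gam hb, ha.matMemLpLoc_Om hb,
    ha.Om_transpose, ?_, ?_⟩
  · rw [compatibility_iff, ← ha.hasCurl_lowGam_iff hb hb_symm]
    exact forall₂_congr fun i j => (ha.hasCurl_Om_iff hb i j).trans (ha.hasCurl_Gam_iff hb i j)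
  · rw [compatibility_iff, gammaCompatibility_iff ha hb]
    exact forall₂_congr fun i j => ha.hasCurl_Om_iff hb i j
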